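/- **Theorem (Morita transform of representations).** Let $M$ and $N$ be $C^*$-algebras (not necessarily unital), let $E$ be a $C^*$-correspondence over $M$ and $F$ a $C^*$-correspondence over $N$: a $C^*$-correspondence over $M$ is a right Hilbert $C^*$-module over $M$ with a left action of $M$ given by a $*$-homomorphism $\varphi_M$ into the adjointable operators. Suppose that $(E,M)$ and $(F,N)$ are Morita equivalent, i.e. that there are an $M$–$N$ equivalence (imprimitivity) bimodule $\mathcal X$ and an isomorphism of $C^*$-correspondences $W: E\otimes_M \mathcal X\to \mathcal X\otimes_N F$ (a linear bijection that preserves the inner products and both actions; $\otimes_M$, $\otimes_N$ are the internal tensor products). For a $*$-representation $\sigma:N\to B(H)$ on a Hilbert space $H$, let $F\otimes_\sigma H$ be the separated completion of the algebraic tensor product with respect to $\langle \xi\otimes h,\eta\otimes k\rangle=\langle h,\sigma(\langle\xi,\eta\rangle)k\rangle$, on which $N$ acts by $b\mapsto\varphi_N(b)\otimes I$. Let $$F^{\sigma}=\{\mathfrak z\in B(H,F\otimes_\sigma H): \mathfrak z\,\sigma(b)=(\varphi_N(b)\otimes I)\,\mathfrak z\ \text{ for all } b\in N\},\qquad F^{\sigma*}=\{\mathfrak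 z^*:\mathfrak z\in F^\sigma\},$$ and let $\overline{\mathbb D(F^{\sigma*})}$ be the closed unit ball of $F^{\sigma*}$ in the operator norm. Let $\sigma^{\mathcal X}$ be the representation of $M$ on $\mathcal X\otimes_\sigma H$ induced by $\mathcal X$, $\sigma^{\mathcal X}(a)(x\otimes h)=ax\otimes h$, and define $E^{\sigma^{\mathcal X}*}$ and its closed unit ball $\overline{\mathbb D(E^{\sigma^{\mathcal X}*})}$ in the same way from $E$ and $\sigma^{\mathcal X}$. Assume that at least one of $\sigma$ and the left action of $N$ on $F$ is nondegenerate, that is, $\sigma(N)H$ spans a dense subspace of $H$ or $\varphi_N(N)F$ spans a dense subspace of $F$. Then for every $\mathfrak z^*\in\overline{\mathbb D(F^{\sigma*})}$ the operator $$\mathfrak z^{*\mathcal X}:=(I_{\mathcal X}\otimes \mathfrak z^*)(W\otimes I_H):\ E\otimes_{\sigma^{\mathcal X}}(\mathcal X\otimes_\sigma H)\to \mathcal X\otimes_\sigma H$$ (with the canonical identifications $E\otimes(\mathcal X\otimes_\sigma H)\cong(E\otimes_M\mathcal X)\otimes_\sigma H$ and $(\mathcal X\otimes_N F)\otimes_\sigma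 H\cong\mathcal X\otimes(F\otimes_\sigma H)$) lies in $\overline{\mathbb D(E^{\sigma^{\mathcal X}*})}$, and the map $\mathfrak z^*\mapsto\mathfrak z^{*\mathcal X}$ is isometric, $\|\mathfrak z_1^{*\mathcal X}-\mathfrak z_2^{*\mathcal X}\|=\|\mathfrak z_1^*-\mathfrak z_2^*\|$, and maps $\overline{\mathbb D(F^{\sigma*})}$ onto $\overline{\mathbb D(E^{\sigma^{\mathcal X}*})}$. -/

import Mathlib

open scoped ComplexOrder TensorProduct
open UniformSpace

noncomputable section

namespace CStarMorita
/-- For self-adjoint `X` the negative part `m` of `X` satisfies `m X m = -m³`. -/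
theorem exists_neg_part {D : Type*} [NonUnitalCStarAlgebra D] [PartialOrder D] [StarOrderedRing D]
    (X : D) (hX : IsSelfAdjoint X) :
    ∃ m : D, 0 ≤ m ∧ m * X * m = - (m * m * m) ∧ (m = 0 → 0 ≤ X) := by
  refine ⟨X⁻, CFC.negPart_nonneg X, ?_, fun h => (CFC.negPart_eq_zero_iff X hX).mp h⟩
  have h : X⁻ * X = -(X⁻ * X⁻) := by
    calc X⁻ * X = X⁻ * (X⁺ - X⁻) := by rw [CFC.posPart_sub_negPart X hX]
      _ = _ := by rw [mul_sub, CFC.negPart_mul_posPart, zero_sub]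
  rw [h, neg_mul]

theorem exists_star_mul_self {D : Type*} [NonUnitalCStarAlgebra D] [PartialOrder D]
    [StarOrderedRing D] {X : D} (hX : 0 ≤ X) : ∃ c, X = star c * c :=
  CStarAlgebra.nonneg_iff_eq_star_mul_self.mp hX

/-- A self-adjoint matrix `x` over a C⋆-algebra with `∑ wᵢ* xᵢⱼ wⱼ ≥ 0` for all `w` is of the form
`s* s`. -/
theorem exists_factor {A : Type*} [NonUnitalCStarAlgebra A] [PartialOrder A] [StarOrderedRing A]
    {ι : Type*} [Fintype ι] [DecidableEq ι] (x : ι → ι → A)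
    (hsa : ∀ i j, star (x i j) = x j i)
    (hpos : ∀ w : ι → A, 0 ≤ ∑ i, ∑ j, star (w i) * x i j * w j) :
    ∃ s : ι → ι → A, ∀ i j, x i j = ∑ k, star (s k i) * s k j := by
  let X : CStarMatrix ι ι A := CStarMatrix.ofMatrix (Matrix.of x)
  have hX : IsSelfAdjoint X := by
    ext i j; exact hsa j i
  obtain ⟨m, hm0, e1, hmX⟩ := exists_neg_part X hX
  have hms : star m = m := (IsSelfAdjoint.of_nonneg hm0).star_eq
  have hmmm : 0 ≤ m * m * m := by
    have := star_left_conjugate_nonneg hm0 m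
    rwa [hms] at this
  obtain ⟨c, hc⟩ := exists_star_mul_self hmmm
  have hc0 : c = 0 := by
    ext k i
    have hd : 0 ≤ (m * X * m) i i := by
      have := hpos (fun l => m l i)
      convert this using 1
      rw [CStarMatrix.mul_apply]
      simp_rw [CStarMatrix.mul_apply, Finset.sum_mul]
      rw [Finset.sum_comm]
      refine Finset.sum_congr rfl fun k _ => Finset.sum_congr rfl fun l _ => ?_
      have : m i k = star (m k i) := by
        conv_lhs => rw [← hms]
        rfl
      rw [this]; rfl
    have hd2 : (m * X * m) i i = - ∑ k, star (c k i) * c k i := by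
      rw [e1, hc]; rfl
    rw [hd2] at hd
    have hn : ∀ k ∈ Finset.univ, 0 ≤ star (c k i) * c k i := fun k _ => star_mul_self_nonneg _
    have h0 : ∑ k, star (c k i) * c k i = 0 :=
      le_antisymm (neg_nonneg.mp hd) (Finset.sum_nonneg hn)
    have := (Finset.sum_eq_zero_iff_of_nonneg hn).mp h0 k (Finset.mem_univ _)
    exact CStarRing.star_mul_self_eq_zero_iff _ |>.mp this
  have h3 : m * m * m = 0 := by rw [hc, hc0]; simp
  have h2 : m * m = 0 := by
    rw [← CStarRing.star_mul_self_eq_zero_iff, star_mul, hms, ← mul_assoc, h3, zero_mul]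
  have h1 : m = 0 := by
    rw [← CStarRing.star_mul_self_eq_zero_iff, hms, h2]
  have hXp : 0 ≤ X := hmX h1
  obtain ⟨s, hs⟩ := exists_star_mul_self hXp
  refine ⟨fun k i => s k i, fun i j => ?_⟩
  have : X i j = (star s * s) i j := by rw [← hs]
  exact this

/-- For self-adjoint `b` with `‖b‖ ≤ 1` there is a self-adjoint `d` with `(1 - d)² = 1 - b`. -/
theorem exists_quad {A : Type*} [NonUnitalCStarAlgebra A] (b : A) (hb : IsSelfAdjoint b)
    (hn : ‖b‖ ≤ 1) : ∃ d : A, star d = d ∧ d + d - d * d = b := by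
  let := CStarAlgebra.spectralOrder A
  have := CStarAlgebra.spectralOrderedRing A
  let f : ℝ → ℝ := fun t => 1 - √(1 - t)
  have hf : Continuous f := by fun_prop
  have hf0 : f 0 = 0 := by simp [f]
  refine ⟨cfcₙ f b, (cfcₙ_predicate f b : IsSelfAdjoint _).star_eq, ?_⟩
  rw [← cfcₙ_add .., ← cfcₙ_mul .., ← cfcₙ_sub ..]
  conv_rhs => rw [← cfcₙ_id' ℝ b]
  refine cfcₙ_congr fun t ht => ?_
  have h1 := NonUnitalIsometricContinuousFunctionalCalculus.norm_quasispectrum_le b ht hb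
  have h2 : 0 ≤ 1 - t := by
    rw [Real.norm_eq_abs] at h1
    linarith [le_abs_self t]
  have h3 := Real.mul_self_sqrt h2
  simp only [f]
  nlinarith

universe u v w

/-- A pre-Hilbert module over the C⋆-algebra `C`: a complex vector space with a positive
semidefinite `C`-valued inner product, conjugate linear in the first and linear in the second
variable, and operators `rmul c` of right multiplication by `c ∈ C`. -/
structure PreHilbertModule (C : Type u) (V : Type v) [NonUnitalCStarAlgebra C] [PartialOrder C]
    [AddCommGroup V] [Module ℂ V] where
  ip : V →ₗ⋆[ℂ] V →ₗ[ℂ] C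
  rmul : C → V →ₗ[ℂ] V
  star_ip : ∀ u v, star (ip u v) = ip v u
  ip_self_nonneg : ∀ u, 0 ≤ ip u u
  ip_rmul : ∀ u v c, ip u (rmul c v) = ip u v * c

namespace PreHilbertModule

variable {C : Type u} {V : Type v} [NonUnitalCStarAlgebra C] [PartialOrder C]
  [AddCommGroup V] [Module ℂ V] (P : PreHilbertModule C V)

theorem rmul_ip (u v : V) (c : C) : P.ip (P.rmul c u) v = star c * P.ip u v := by
  rw [← P.star_ip, P.ip_rmul, star_mul, P.star_ip]

variable [StarOrderedRing C]

/-- The Cauchy-Schwarz inequality. -/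
theorem cauchySchwarz_sq (u v : V) : ‖P.ip u v‖ ^ 2 ≤ ‖P.ip u u‖ * ‖P.ip v v‖ := by
  have key : ∀ t : ℝ, ‖P.ip u u‖ < t → ‖P.ip u v‖ ^ 2 ≤ t * ‖P.ip v v‖ := by
    intro t ht
    have ht0 : 0 < t := (norm_nonneg _).trans_lt ht
    set a := P.ip u v with ha
    have h0 := P.ip_self_nonneg (P.rmul a u - (t : ℂ) • v)
    have hva : P.ip v u = star a := by rw [ha, P.star_ip]
    have e : P.ip (P.rmul a u - (t : ℂ) • v) (P.rmul a u - (t : ℂ) • v)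
        = star a * P.ip u u * a - (2 * t) • (star a * a) + (t ^ 2) • P.ip v v := by
      have e1 : ∀ w, P.ip (P.rmul a u - (t : ℂ) • v) w
          = star a * P.ip u w - (t : ℂ) • P.ip v w := fun w => by
        rw [map_sub, LinearMap.sub_apply, P.rmul_ip, LinearMap.map_smulₛₗ, LinearMap.smul_apply,
          Complex.conj_ofReal]
      rw [map_sub, map_smul, P.ip_rmul, e1, e1, hva, ← ha, Complex.coe_smul, Complex.coe_smul,
        sub_mul, smul_mul_assoc, Complex.coe_smul]
      module
    rw [e] at h0
    have hsa : IsSelfAdjoint (P.ip u u) := P.star_ip u u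
    have h1 : star a * P.ip u u * a ≤ ‖P.ip u u‖ • (star a * a) :=
      CStarAlgebra.star_left_conjugate_le_norm_smul hsa
    have hp : 0 ≤ star a * a := star_mul_self_nonneg a
    have h2 : ‖P.ip u u‖ • (star a * a) ≤ t • (star a * a) :=
      smul_le_smul_of_nonneg_right ht.le hp
    have h3 : t • (star a * a) ≤ (t ^ 2) • P.ip v v := by
      have : 0 ≤ t • (star a * a) - (2 * t) • (star a * a) + (t ^ 2) • P.ip v v :=
        h0.trans (by gcongr; exact h1.trans h2)
      rw [← sub_nonneg]
      convert this using 1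
      module
    have h4 := CStarAlgebra.norm_le_norm_of_nonneg_of_le (smul_nonneg ht0.le hp) h3
    rw [norm_smul, norm_smul, CStarRing.norm_star_mul_self, Real.norm_of_nonneg ht0.le,
      Real.norm_of_nonneg (by positivity)] at h4
    have : t * ‖a‖ ^ 2 ≤ t * (t * ‖P.ip v v‖) := by nlinarith
    exact le_of_mul_le_mul_left this ht0
  refine le_of_forall_pos_le_add fun ε hε => ?_
  have hv : (0 : ℝ) < ‖P.ip v v‖ + 1 := by positivity
  have := key (‖P.ip u u‖ + ε / (‖P.ip v v‖ + 1)) (by linarith [div_pos hε hv])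
  refine this.trans ?_
  rw [add_mul, div_mul_eq_mul_div]
  gcongr
  rw [div_le_iff₀ hv]
  nlinarith [norm_nonneg (P.ip v v)]

theorem cauchySchwarz (u v : V) : ‖P.ip u v‖ ≤ √‖P.ip u u‖ * √‖P.ip v v‖ := by
  rw [← Real.sqrt_mul (norm_nonneg _)]
  exact Real.le_sqrt_of_sq_le (P.cauchySchwarz_sq u v)

/-- The underlying space of a pre-Hilbert module with the seminorm `‖u‖ = ‖⟨u, u⟩‖ ^ (1 / 2)`. -/
@[nolint unusedArguments]
def Space (_ : PreHilbertModule C V) : Type v := V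

instance : AddCommGroup P.Space := inferInstanceAs (AddCommGroup V)
instance : Module ℂ P.Space := inferInstanceAs (Module ℂ V)
instance : Norm P.Space := ⟨fun u => √‖P.ip u u‖⟩

theorem norm_def (u : P.Space) : ‖u‖ = √‖P.ip u u‖ := rfl

theorem seminormedSpaceCore : SeminormedSpace.Core ℂ P.Space where
  norm_nonneg _ := Real.sqrt_nonneg _
  norm_smul c x := by
    rw [norm_def, norm_def]
    have : P.ip (c • x : P.Space) (c • x : P.Space) = (starRingEnd ℂ c * c) • P.ip x x := by
      erw [P.ip.map_smulₛₗ, LinearMap.smul_apply, map_smul, smul_smul]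
    rw [this, norm_smul, norm_mul, RCLike.norm_conj, Real.sqrt_mul (by positivity),
      Real.sqrt_mul_self (norm_nonneg _)]
  norm_triangle x y := by
    have e : P.ip (x + y : P.Space) (x + y : P.Space)
        = P.ip x x + P.ip x y + (P.ip y x + P.ip y y) := by
      erw [P.ip.map_add, LinearMap.add_apply, map_add, map_add]
    rw [norm_def, norm_def, norm_def, e]
    apply Real.sqrt_le_iff.mpr ⟨by positivity, ?_⟩
    have h1 := P.cauchySchwarz x y
    have h2 := P.cauchySchwarz y x
    have h3 := Real.sq_sqrt (norm_nonneg (P.ip x x))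
    have h4 := Real.sq_sqrt (norm_nonneg (P.ip y y))
    calc _ ≤ ‖P.ip x x‖ + ‖P.ip x y‖ + (‖P.ip y x‖ + ‖P.ip y y‖) :=
          (norm_add_le _ _).trans (add_le_add (norm_add_le _ _) (norm_add_le _ _))
      _ ≤ _ := by nlinarith

instance : SeminormedAddCommGroup P.Space := .ofCore P.seminormedSpaceCore
instance : NormedSpace ℂ P.Space where
  norm_smul_le c x := (P.seminormedSpaceCore.norm_smul c x).le

theorem norm_sq (u : P.Space) : ‖u‖ ^ 2 = ‖P.ip u u‖ := Real.sq_sqrt (norm_nonneg _)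

/-- The inner product as a bounded sesquilinear map. -/
def ipL : P.Space →L⋆[ℂ] P.Space →L[ℂ] C :=
  LinearMap.mkContinuous₂ P.ip 1 fun u v => by
    rw [one_mul]; exact P.cauchySchwarz u v

/-- The inner product of the completion. -/
def ipCompletion : Completion P.Space →L⋆[ℂ] Completion P.Space →L[ℂ] C :=
  (P.ipL.fromCompletion.flip.fromCompletion).flip

theorem ipL_apply (u v : P.Space) : P.ipL u v = P.ip u v := rfl

@[simp]
theorem ipCompletion_coe (u v : P.Space) :
    P.ipCompletion (u : Completion P.Space) (v : Completion P.Space) = P.ip u v := by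
  rw [ipCompletion, ContinuousLinearMap.flip_apply, ContinuousLinearMap.fromCompletion_apply_coe,
    ContinuousLinearMap.flip_apply, ContinuousLinearMap.fromCompletion_apply_coe, ipL_apply]

theorem norm_rmul_sq_le (c : C) (u : V) : ‖P.ip (P.rmul c u) (P.rmul c u)‖ ≤ ‖c‖ ^ 2 * ‖P.ip u u‖ := by
  rw [P.ip_rmul, P.rmul_ip]
  calc _ ≤ ‖star c‖ * ‖P.ip u u‖ * ‖c‖ :=
        (norm_mul_le _ _).trans (by gcongr; exact norm_mul_le _ _)
    _ = _ := by rw [norm_star]; ring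

/-- The identity map onto the seminormed space. -/
def toSpace : V ≃ₗ[ℂ] P.Space where
  toFun u := u
  invFun u := u
  map_add' _ _ := rfl
  map_smul' _ _ := rfl
  left_inv _ := rfl
  right_inv _ := rfl

/-- The canonical map into the (separated) completion. -/
def emb : V →ₗ[ℂ] Completion P.Space :=
  (Completion.toComplL : P.Space →L[ℂ] Completion P.Space).toLinearMap ∘ₗ P.toSpace.toLinearMap

theorem denseRange_emb : DenseRange P.emb :=
  Completion.denseRange_coe (α := P.Space)

theorem norm_emb_sq (u : V) : ‖P.emb u‖ ^ 2 = ‖P.ip u u‖ := by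
  refine Eq.trans ?_ (P.norm_sq u)
  congr 1
  exact Completion.norm_coe (E := P.Space) u

theorem ipCompletion_emb (u v : V) : P.ipCompletion (P.emb u) (P.emb v) = P.ip u v :=
  P.ipCompletion_coe u v

theorem exists_bound_of_sq {W' : Type*} [NormedAddCommGroup W'] [NormedSpace ℂ W'] (f : V →ₗ[ℂ] W') (K : ℝ) (hK : 0 ≤ K)
    (h : ∀ u, ‖f u‖ ^ 2 ≤ K ^ 2 * ‖P.ip u u‖) : ∀ u, ‖f u‖ ≤ K * ‖P.emb u‖ := fun u => by
  rw [← sq_le_sq₀ (norm_nonneg _) (by positivity), mul_pow, P.norm_emb_sq]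
  exact h u

/-- Contractivity of a `*`-representation by adjointable operators on a pre-Hilbert module. -/
theorem norm_starRep_sq_le {A : Type w} [NonUnitalCStarAlgebra A]
    (L : A →ₙₐ[ℂ] Module.End ℂ V) (hL : ∀ a u v, P.ip (L a u) v = P.ip u (L (star a) v))
    (a : A) (u : V) : ‖P.ip (L a u) (L a u)‖ ≤ ‖a‖ ^ 2 * ‖P.ip u u‖ := by
  rcases eq_or_ne a 0 with rfl | ha
  · simp
  have hpos : 0 < ‖a‖ ^ 2 := by positivity
  set r : ℝ := (‖a‖ ^ 2)⁻¹ with hr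
  have hr0 : 0 < r := inv_pos.mpr hpos
  obtain ⟨d, hd, hdb⟩ := exists_quad (r • (star a * a))
    (IsSelfAdjoint.smul (IsSelfAdjoint.all r) (IsSelfAdjoint.star_mul_self a))
    (by rw [norm_smul, CStarRing.norm_star_mul_self, Real.norm_of_nonneg hr0.le, hr, ← sq,
          inv_mul_cancel₀ hpos.ne'])
  have h0 := P.ip_self_nonneg (u - L d u)
  have e1 : P.ip (L a u) (L a u) = P.ip u (L (star a * a) u) := by
    rw [hL, map_mul]; rfl
  have e2 : P.ip (u - L d u) (u - L d u) = P.ip u u - r • P.ip u (L (star a * a) u) := by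
    have : r • (star a * a) = (r : ℂ) • (star a * a) := (Complex.coe_smul r _).symm
    rw [this] at hdb
    rw [← Complex.coe_smul, ← map_smul, ← LinearMap.smul_apply, ← map_smul L, ← hdb, map_sub L,
      map_add L, map_mul L]
    simp only [map_sub, LinearMap.sub_apply, hL, hd, map_add, LinearMap.add_apply,
      Module.End.mul_apply]
    abel
  rw [e2, sub_nonneg] at h0
  have h1 : 0 ≤ P.ip (L a u) (L a u) := P.ip_self_nonneg _
  rw [← e1] at h0
  have h2 := CStarAlgebra.norm_le_norm_of_nonneg_of_le (smul_nonneg hr0.le h1) h0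
  rw [norm_smul, Real.norm_of_nonneg hr0.le, hr, inv_mul_le_iff₀ hpos] at h2
  exact h2

end PreHilbertModule

/-- A (right) Hilbert C⋆-module over `B`: a Banach space with a `B`-valued inner product `ip`,
conjugate linear in the first and linear in the second variable, such that `‖x‖² = ‖⟨x, x⟩‖`,
and a right multiplication `rmul b x = x · b` with `⟨x, y · b⟩ = ⟨x, y⟩ b`. The remaining laws of a
right module follow, because the inner product is definite; see `rmul_mul` and `rmul_add`.
(Mathlib's `CStarModule` is set up for left multiplications.) -/
structure HilbertModule (B : Type u) [NonUnitalCStarAlgebra B] [PartialOrder B] where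
  carrier : Type v
  [normedAddCommGroup : NormedAddCommGroup carrier]
  [normedSpace : NormedSpace ℂ carrier]
  [completeSpace : CompleteSpace carrier]
  ip : carrier →ₗ⋆[ℂ] carrier →ₗ[ℂ] B
  rmul : B → carrier →ₗ[ℂ] carrier
  star_ip : ∀ x y, star (ip x y) = ip y x
  ip_self_nonneg : ∀ x, 0 ≤ ip x x
  ip_rmul : ∀ x y b, ip x (rmul b y) = ip x y * b
  norm_sq : ∀ x, ‖x‖ ^ 2 = ‖ip x x‖

attribute [instance] HilbertModule.normedAddCommGroup HilbertModule.normedSpace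
  HilbertModule.completeSpace

instance {B : Type u} [NonUnitalCStarAlgebra B] [PartialOrder B] :
    CoeSort (HilbertModule.{u, v} B) (Type v) := ⟨HilbertModule.carrier⟩

/-- A C⋆-correspondence from `A` to `B`: a right Hilbert `B`-module with a left action of `A` by a
`*`-homomorphism `φ = lmul` into the adjointable operators, i.e. `φ(a)* = φ(a*)`. A
C⋆-correspondence over `M` is a `Corr M M`. -/
structure Corr (A : Type w) (B : Type u) [NonUnitalCStarAlgebra A] [NonUnitalCStarAlgebra B]
    [PartialOrder B] extends HilbertModule.{u, v} B where
  lmul : A →ₙₐ[ℂ] (carrier →L[ℂ] carrier)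
  ip_lmul : ∀ a x y, ip (lmul a x) y = ip x (lmul (star a) y)

instance {A : Type w} {B : Type u} [NonUnitalCStarAlgebra A] [NonUnitalCStarAlgebra B]
    [PartialOrder B] : CoeSort (Corr.{u, v, w} A B) (Type v) := ⟨fun E => E.carrier⟩

namespace HilbertModule

variable {B : Type u} [NonUnitalCStarAlgebra B] [PartialOrder B] (E : HilbertModule.{u, v} B)

theorem ext_ip {x y : E} (h : ∀ z : E, E.ip z x = E.ip z y) : x = y := by
  have h1 : ‖x - y‖ ^ 2 = 0 := by
    rw [E.norm_sq, map_sub (E.ip (x - y)), h, sub_self, norm_zero]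
  exact sub_eq_zero.mp (norm_eq_zero.mp (pow_eq_zero_iff two_ne_zero |>.mp h1))

/-- The axioms of a right module follow from those of the inner product. -/
theorem rmul_mul (x : E) (b c : B) : E.rmul (b * c) x = E.rmul c (E.rmul b x) :=
  E.ext_ip fun z => by simp only [E.ip_rmul, mul_assoc]

theorem rmul_add (x : E) (b c : B) : E.rmul (b + c) x = E.rmul b x + E.rmul c x :=
  E.ext_ip fun z => by simp only [E.ip_rmul, mul_add, map_add]

/-- A Hilbert module over `ℂ` is a Hilbert space. -/
instance (K : HilbertModule.{0, v} ℂ) : InnerProductSpace ℂ K where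
  inner x y := K.ip x y
  norm_sq_eq_re_inner x := by
    have h := K.ip_self_nonneg x
    rw [K.norm_sq]
    conv_rhs => rw [Complex.eq_coe_norm_of_nonneg h]
    exact (Complex.ofReal_re _).symm
  conj_inner_symm x y := K.star_ip y x
  add_left x y z := by rw [map_add, LinearMap.add_apply]
  smul_left x y c := by rw [LinearMap.map_smulₛₗ, LinearMap.smul_apply, smul_eq_mul]

theorem inner_eq_ip (K : HilbertModule.{0, v} ℂ) (x y : K) : inner ℂ x y = K.ip x y := rfl

variable [StarOrderedRing B]

/-- A Hilbert module is a pre-Hilbert module. -/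
def toPre : PreHilbertModule B E where
  ip := E.ip
  rmul := E.rmul
  star_ip := E.star_ip
  ip_self_nonneg := E.ip_self_nonneg
  ip_rmul := E.ip_rmul

theorem norm_ip_le (x y : E) : ‖E.ip x y‖ ≤ ‖x‖ * ‖y‖ := by
  have h := E.toPre.cauchySchwarz x y
  have e : ∀ z : E, √‖E.ip z z‖ = ‖z‖ := fun z => by
    rw [← E.norm_sq, Real.sqrt_sq (norm_nonneg _)]
  rwa [show E.toPre.ip = E.ip from rfl, e, e] at h

/-- The inner product as a bounded sesquilinear map. -/
def ipL : E →L⋆[ℂ] E →L[ℂ] B :=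
  LinearMap.mkContinuous₂ E.ip 1 fun u v => by
    rw [one_mul]; exact E.norm_ip_le u v

theorem ipL_apply (x y : E) : E.ipL x y = E.ip x y := rfl

theorem continuous_ip {T : Type*} [TopologicalSpace T] {f g : T → E} (hf : Continuous f)
    (hg : Continuous g) : Continuous fun t => E.ip (f t) (g t) := by
  simp_rw [← ipL_apply]
  fun_prop

end HilbertModule

namespace PreHilbertModule

variable {C : Type u} {V : Type v} [NonUnitalCStarAlgebra C] [PartialOrder C]
  [AddCommGroup V] [Module ℂ V] [StarOrderedRing C] (P : PreHilbertModule C V)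

/-- Extension to the completion of a bounded linear map -/
def extend (f : V →ₗ[ℂ] V) : Completion P.Space →L[ℂ] Completion P.Space :=
  (P.emb ∘ₗ f).extendOfNorm P.emb

theorem extend_emb (f : V →ₗ[ℂ] V) (K : ℝ) (hK : 0 ≤ K)
    (h : ∀ u, ‖P.ip (f u) (f u)‖ ≤ K ^ 2 * ‖P.ip u u‖) (u : V) :
    P.extend f (P.emb u) = P.emb (f u) :=
  LinearMap.extendOfNorm_eq P.denseRange_emb
    ⟨K, P.exists_bound_of_sq (P.emb ∘ₗ f) K hK fun u => by
      rw [LinearMap.comp_apply, P.norm_emb_sq]; exact h u⟩ u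

theorem continuous_ipCompletion {T : Type*} [TopologicalSpace T] {f g : T → Completion P.Space}
    (hf : Continuous f) (hg : Continuous g) :
    Continuous fun t => P.ipCompletion (f t) (g t) := by
  fun_prop

/-- The Hilbert module obtained by separated completion. -/
def hilbert : HilbertModule.{u, v} C where
  carrier := Completion P.Space
  ip := LinearMap.mk₂'ₛₗ _ _ (fun x y => P.ipCompletion x y) (by simp) (by simp) (by simp) (by simp)
  rmul c := (P.extend (P.rmul c)).toLinearMap
  star_ip x y := by
    refine P.denseRange_emb.induction_on₂ (isClosed_eq ?_ ?_) (fun u v => ?_) x y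
    · exact continuous_star.comp (P.continuous_ipCompletion continuous_fst continuous_snd)
    · exact P.continuous_ipCompletion continuous_snd continuous_fst
    · simp only [LinearMap.mk₂'ₛₗ_apply, ipCompletion_emb, P.star_ip]
  ip_self_nonneg x := by
    refine P.denseRange_emb.induction_on x (isClosed_le continuous_const ?_) (fun u => ?_)
    · exact P.continuous_ipCompletion continuous_id continuous_id
    · simp only [LinearMap.mk₂'ₛₗ_apply, ipCompletion_emb, P.ip_self_nonneg]
  ip_rmul x y c := by
    refine P.denseRange_emb.induction_on₂ (isClosed_eq ?_ ?_) (fun u v => ?_) x y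
    · exact P.continuous_ipCompletion continuous_fst
        ((P.extend (P.rmul c)).continuous.comp continuous_snd)
    · exact (P.continuous_ipCompletion continuous_fst continuous_snd).mul continuous_const
    · simp only [LinearMap.mk₂'ₛₗ_apply, ContinuousLinearMap.coe_coe,
        P.extend_emb (P.rmul c) ‖c‖ (norm_nonneg _) (P.norm_rmul_sq_le c), ipCompletion_emb,
        P.ip_rmul]
  norm_sq x := by
    refine P.denseRange_emb.induction_on x (isClosed_eq ?_ ?_) (fun u => ?_)
    · exact continuous_norm.pow 2
    · exact continuous_norm.comp (P.continuous_ipCompletion continuous_id continuous_id)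
    · simp only [LinearMap.mk₂'ₛₗ_apply, ipCompletion_emb, P.norm_emb_sq]

theorem extend_starRep {A : Type w} [NonUnitalCStarAlgebra A] (L : A →ₙₐ[ℂ] Module.End ℂ V)
    (hL : ∀ a u v, P.ip (L a u) v = P.ip u (L (star a) v)) (a : A) (u : V) :
    P.extend (L a) (P.emb u) = P.emb (L a u) :=
  P.extend_emb (L a) ‖a‖ (norm_nonneg _) (P.norm_starRep_sq_le L hL a) u

theorem clm_ext {Z : Type*} [NormedAddCommGroup Z] [NormedSpace ℂ Z]
    {f g : Completion P.Space →L[ℂ] Z} (h : ∀ u, f (P.emb u) = g (P.emb u)) : f = g :=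
  ContinuousLinearMap.coeFn_injective
    (P.denseRange_emb.equalizer f.continuous g.continuous (funext h))

/-- The left action on the completion. -/
def lmulCompletion {A : Type w} [NonUnitalCStarAlgebra A] (L : A →ₙₐ[ℂ] Module.End ℂ V)
    (hL : ∀ a u v, P.ip (L a u) v = P.ip u (L (star a) v)) :
    A →ₙₐ[ℂ] (Completion P.Space →L[ℂ] Completion P.Space) :=
  have e := P.extend_starRep L hL
  { toFun := fun a => P.extend (L a)
    map_smul' := fun c a => P.clm_ext fun u => by
      rw [ContinuousLinearMap.smul_apply, e, e, map_smul L]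
      simp
    map_zero' := P.clm_ext fun u => by
      rw [e, map_zero L]
      simp
    map_add' := fun a b => P.clm_ext fun u => by
      rw [ContinuousLinearMap.add_apply, e, e, e, map_add L]
      simp
    map_mul' := fun a b => P.clm_ext fun u => by
      rw [ContinuousLinearMap.mul_apply, e, e, e, map_mul L]
      simp }

/-- The correspondence obtained by separated completion, when `A` acts by adjointable operators. -/
def corr {A : Type w} [NonUnitalCStarAlgebra A] (L : A →ₙₐ[ℂ] Module.End ℂ V)
    (hL : ∀ a u v, P.ip (L a u) v = P.ip u (L (star a) v)) : Corr.{u, v, w} A C where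
  toHilbertModule := P.hilbert
  lmul := P.lmulCompletion L hL
  ip_lmul a x y := by
    have e := P.extend_starRep L hL
    change P.ipCompletion (P.extend (L a) x) y = P.ipCompletion x (P.extend (L (star a)) y)
    refine P.denseRange_emb.induction_on₂ (isClosed_eq ?_ ?_) (fun u v => ?_) x y
    · exact P.continuous_ipCompletion ((P.extend _).continuous.comp continuous_fst) continuous_snd
    · exact P.continuous_ipCompletion continuous_fst ((P.extend _).continuous.comp continuous_snd)
    · rw [e, e, ipCompletion_emb, ipCompletion_emb, hL]

end PreHilbertModule

theorem HilbertModule.rmul_ip {B : Type u} [NonUnitalCStarAlgebra B] [PartialOrder B]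
    (E : HilbertModule.{u, v} B) (x y : E) (b : B) :
    E.ip (E.rmul b x) y = star b * E.ip x y := by
  rw [← E.star_ip, E.ip_rmul, star_mul, E.star_ip]

namespace Corr

section Tensor

variable {A : Type*} {B : Type*} {C : Type*} [NonUnitalCStarAlgebra A] [NonUnitalCStarAlgebra B]
  [NonUnitalCStarAlgebra C] [PartialOrder B] [StarOrderedRing B] [PartialOrder C]
  [StarOrderedRing C] (X : Corr.{_, v, _} A B) (Y : Corr.{_, w, _} B C)

/-- The form `⟨x ⊗ y, x' ⊗ y'⟩ = ⟨y, φ(⟨x, x'⟩) y'⟩` on the algebraic tensor product. -/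
def tensorForm : X ⊗[ℂ] Y →ₗ⋆[ℂ] X ⊗[ℂ] Y →ₗ[ℂ] C :=
  TensorProduct.lift <| LinearMap.mk₂'ₛₗ (starRingEnd ℂ) (starRingEnd ℂ)
    (fun x y => TensorProduct.lift <| LinearMap.mk₂ ℂ
      (fun x' y' => Y.ip y (Y.lmul (X.ip x x') y'))
      (by simp) (by simp) (by simp) (by simp))
    (fun _ _ _ => TensorProduct.ext' fun _ _ => by simp)
    (fun c x y => TensorProduct.ext' fun _ _ => by simp)
    (fun _ _ _ => TensorProduct.ext' fun _ _ => by simp)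
    (fun c x y => TensorProduct.ext' fun _ _ => by simp)

theorem tensorForm_tmul (x x' : X) (y y' : Y) :
    tensorForm X Y (x ⊗ₜ y) (x' ⊗ₜ y') = Y.ip y (Y.lmul (X.ip x x') y') := rfl

/-- For finitely many `xᵢ` there is a matrix `s` over `B` with `⟨xᵢ, xⱼ⟩ = ∑ₖ sₖᵢ* sₖⱼ`. -/
theorem exists_factor_ip {ι : Type*} [Fintype ι] [DecidableEq ι] (x : ι → X) :
    ∃ s : ι → ι → B, ∀ i j, X.ip (x i) (x j) = ∑ k, star (s k i) * s k j := by
  refine exists_factor _ (fun i j => X.star_ip _ _) fun w => ?_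
  have h := X.ip_self_nonneg (∑ i, X.rmul (w i) (x i))
  convert h using 1
  simp only [map_sum, LinearMap.sum_apply, X.rmul_ip, X.ip_rmul, mul_assoc]
  exact Finset.sum_comm

theorem tensorForm_sum {ι : Type*} [Fintype ι] (x : ι → X) (y : ι → Y) (s : ι → ι → B)
    (hs : ∀ i j, X.ip (x i) (x j) = ∑ k, star (s k i) * s k j) :
    tensorForm X Y (∑ i, x i ⊗ₜ y i) (∑ i, x i ⊗ₜ y i)
      = ∑ k, Y.ip (∑ i, Y.lmul (s k i) (y i)) (∑ i, Y.lmul (s k i) (y i)) := by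
  have e1 : tensorForm X Y (∑ i, x i ⊗ₜ y i) (∑ i, x i ⊗ₜ y i)
      = ∑ j, ∑ i, Y.ip (y i) (Y.lmul (X.ip (x i) (x j)) (y j)) := by
    simp only [map_sum, LinearMap.sum_apply]
    rfl
  have e2 : ∀ k, Y.ip (∑ i, Y.lmul (s k i) (y i)) (∑ i, Y.lmul (s k i) (y i))
      = ∑ j, ∑ i, Y.ip (y i) (Y.lmul (star (s k i) * s k j) (y j)) := fun k => by
    simp only [map_sum, LinearMap.sum_apply, Y.ip_lmul, map_mul]
    rfl
  rw [e1, Finset.sum_congr rfl fun k _ => e2 k]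
  simp only [hs, map_sum, sum_apply]
  rw [Finset.sum_comm (γ := ι)]
  conv_rhs => rw [Finset.sum_comm]
  rw [Finset.sum_comm]
  refine Finset.sum_congr rfl fun j _ => ?_
  rw [Finset.sum_comm]

theorem exists_sum_tmul (u : X ⊗[ℂ] Y) :
    ∃ (S : Finset (X × Y)), u = ∑ i : S, i.1.1 ⊗ₜ i.1.2 := by
  obtain ⟨S, hS⟩ := TensorProduct.exists_finset u
  exact ⟨S, by rw [hS, ← Finset.sum_coe_sort]⟩

/-- The pre-Hilbert module structure on the algebraic tensor product. -/
def preTensor : PreHilbertModule C (X ⊗[ℂ] Y) where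
  ip := tensorForm X Y
  rmul c := (Y.rmul c).lTensor X
  star_ip u v := by
    induction u with
    | zero => simp
    | add u u' hu hu' => rw [map_add, LinearMap.add_apply, star_add, hu, hu', map_add]
    | tmul x y =>
      induction v with
      | zero => simp
      | add v v' hv hv' => rw [map_add, star_add, hv, hv', map_add, LinearMap.add_apply]
      | tmul x' y' => rw [tensorForm_tmul, tensorForm_tmul, Y.star_ip, Y.ip_lmul, X.star_ip]
  ip_self_nonneg u := by
    classical
    obtain ⟨S, rfl⟩ := exists_sum_tmul X Y u
    obtain ⟨s, hs⟩ := X.exists_factor_ip fun i : S => i.1.1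
    rw [tensorForm_sum X Y _ _ s hs]
    exact Finset.sum_nonneg fun k _ => Y.ip_self_nonneg _
  ip_rmul u v c := by
    induction u with
    | zero => simp
    | add u u' hu hu' => rw [map_add, LinearMap.add_apply, LinearMap.add_apply, hu, hu', add_mul]
    | tmul x y =>
      induction v with
      | zero => simp
      | add v v' hv hv' => simp only [map_add, hv, hv', add_mul]
      | tmul x' y' =>
        have e : ∀ z, Y.ip y (Y.lmul (X.ip x x') z) = Y.ip (Y.lmul (star (X.ip x x')) y) z :=
          fun z => by rw [Y.ip_lmul, star_star]
        rw [LinearMap.lTensor_tmul, tensorForm_tmul, tensorForm_tmul, e, e, Y.ip_rmul]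

/-- The action `a ↦ φ(a) ⊗ 1` on the algebraic tensor product. -/
def preLmul : A →ₙₐ[ℂ] Module.End ℂ (X ⊗[ℂ] Y) where
  toFun a := (X.lmul a).toLinearMap.rTensor Y
  map_smul' c a := TensorProduct.ext' fun x y => by simp [TensorProduct.smul_tmul']
  map_zero' := TensorProduct.ext' fun x y => by simp
  map_add' a b := TensorProduct.ext' fun x y => by simp [TensorProduct.add_tmul]
  map_mul' a b := TensorProduct.ext' fun x y => by simp

theorem preLmul_tmul (a : A) (x : X) (y : Y) :
    preLmul X Y a (x ⊗ₜ y) = X.lmul a x ⊗ₜ y := rfl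

theorem tensorForm_preLmul (a : A) (u v : X ⊗[ℂ] Y) :
    (preTensor X Y).ip (preLmul X Y a u) v = (preTensor X Y).ip u (preLmul X Y (star a) v) := by
  induction u with
  | zero => simp
  | add u u' hu hu' => simp only [map_add, LinearMap.add_apply, hu, hu']
  | tmul x y =>
    induction v with
    | zero => simp
    | add v v' hv hv' => simp only [map_add, hv, hv']
    | tmul x' y' =>
      rw [preLmul_tmul, preLmul_tmul]
      change tensorForm X Y _ _ = tensorForm X Y _ _
      rw [tensorForm_tmul, tensorForm_tmul, X.ip_lmul]

/-- The internal tensor product `X ⊗_B Y` of correspondences: the separated completion of the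
algebraic tensor product. It is balanced, since `x · b ⊗ y - x ⊗ φ(b) y` has length zero. -/
def tensor : Corr.{_, max v w, _} A C :=
  (preTensor X Y).corr (preLmul X Y) (tensorForm_preLmul X Y)

/-- The canonical map from the algebraic tensor product. -/
def inc : X ⊗[ℂ] Y →ₗ[ℂ] X.tensor Y := (preTensor X Y).emb

/-- The elementary tensor `x ⊗ y`. -/
def tmul (x : X) (y : Y) : X.tensor Y := inc X Y (x ⊗ₜ y)

theorem denseRange_inc : DenseRange (inc X Y) := (preTensor X Y).denseRange_emb

theorem ip_inc (u v : X ⊗[ℂ] Y) : (X.tensor Y).ip (inc X Y u) (inc X Y v) = tensorForm X Y u v :=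
  (preTensor X Y).ipCompletion_emb u v

theorem norm_inc_sq (u : X ⊗[ℂ] Y) : ‖inc X Y u‖ ^ 2 = ‖tensorForm X Y u u‖ :=
  (preTensor X Y).norm_emb_sq u

theorem ip_tmul (x x' : X) (y y' : Y) :
    (X.tensor Y).ip (tmul X Y x y) (tmul X Y x' y') = Y.ip y (Y.lmul (X.ip x x') y') :=
  ip_inc X Y _ _

theorem lmul_tmul (a : A) (x : X) (y : Y) :
    (X.tensor Y).lmul a (tmul X Y x y) = tmul X Y (X.lmul a x) y :=
  (preTensor X Y).extend_starRep (preLmul X Y) (tensorForm_preLmul X Y) a (x ⊗ₜ y)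

theorem rmul_tmul (c : C) (x : X) (y : Y) :
    (X.tensor Y).rmul c (tmul X Y x y) = tmul X Y x (Y.rmul c y) :=
  (preTensor X Y).extend_emb _ ‖c‖ (norm_nonneg _) ((preTensor X Y).norm_rmul_sq_le c) (x ⊗ₜ y)

variable {X Y} in
theorem tensor_ext {Z : Type*} [NormedAddCommGroup Z] [NormedSpace ℂ Z]
    {f g : X.tensor Y →L[ℂ] Z} (h : ∀ x y, f (tmul X Y x y) = g (tmul X Y x y)) : f = g :=
  ContinuousLinearMap.coeFn_injective <|
    (denseRange_inc X Y).equalizer f.continuous g.continuous <| funext fun u =>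
      LinearMap.congr_fun (f := f.toLinearMap ∘ₗ inc X Y) (g := g.toLinearMap ∘ₗ inc X Y)
        (TensorProduct.ext' h) u

/-- Extension to `X ⊗_B Y` of a bounded linear map on the algebraic tensor product. -/
def lift {Z : Type*} [NormedAddCommGroup Z] [NormedSpace ℂ Z] [CompleteSpace Z]
    (f : X ⊗[ℂ] Y →ₗ[ℂ] Z) : X.tensor Y →L[ℂ] Z :=
  f.extendOfNorm (inc X Y)

theorem lift_inc {Z : Type*} [NormedAddCommGroup Z] [NormedSpace ℂ Z] [CompleteSpace Z]
    (f : X ⊗[ℂ] Y →ₗ[ℂ] Z) (K : ℝ) (hK : 0 ≤ K) (h : ∀ u, ‖f u‖ ^ 2 ≤ K ^ 2 * ‖tensorForm X Y u u‖)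
    (u : X ⊗[ℂ] Y) : lift X Y f (inc X Y u) = f u :=
  LinearMap.extendOfNorm_eq (denseRange_inc X Y)
    ⟨K, (preTensor X Y).exists_bound_of_sq f K hK h⟩ u

/-- A linear map on the algebraic tensor product that preserves the form extends to an isometry. -/
def liftIsometry {Z : Type*} [NormedAddCommGroup Z] [NormedSpace ℂ Z] [CompleteSpace Z]
    (f : X ⊗[ℂ] Y →ₗ[ℂ] Z) (h : ∀ u, ‖f u‖ ^ 2 = ‖tensorForm X Y u u‖) :
    X.tensor Y →ₗᵢ[ℂ] Z where
  toLinearMap := (lift X Y f).toLinearMap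
  norm_map' z := by
    refine (denseRange_inc X Y).induction_on z (isClosed_eq ?_ ?_) fun u => ?_
    · exact (lift X Y f).continuous.norm
    · exact continuous_norm
    · rw [ContinuousLinearMap.coe_coe, lift_inc X Y f 1 zero_le_one (by simp [h]),
        ← sq_eq_sq₀ (norm_nonneg _) (norm_nonneg _), h, norm_inc_sq]

theorem liftIsometry_inc {Z : Type*} [NormedAddCommGroup Z] [NormedSpace ℂ Z] [CompleteSpace Z]
    (f : X ⊗[ℂ] Y →ₗ[ℂ] Z) (h : ∀ u, ‖f u‖ ^ 2 = ‖tensorForm X Y u u‖) (u : X ⊗[ℂ] Y) :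
    liftIsometry X Y f h (inc X Y u) = f u :=
  lift_inc X Y f 1 zero_le_one (by simp [h]) u

theorem liftIsometry_surjective {Z : Type*} [NormedAddCommGroup Z] [NormedSpace ℂ Z]
    [CompleteSpace Z] (f : X ⊗[ℂ] Y →ₗ[ℂ] Z) (h : ∀ u, ‖f u‖ ^ 2 = ‖tensorForm X Y u u‖)
    (hf : DenseRange f) : Function.Surjective (liftIsometry X Y f h) := by
  have hc : IsClosed (Set.range (liftIsometry X Y f h)) :=
    (liftIsometry X Y f h).isometry.isClosedEmbedding.isClosed_range
  rw [← Set.range_eq_univ, ← hc.closure_eq]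
  refine Dense.closure_eq (hf.mono ?_)
  rintro _ ⟨u, rfl⟩
  exact ⟨inc X Y u, liftIsometry_inc X Y f h u⟩

end Tensor

section Rep

variable {A : Type*} {B : Type*} {C : Type*} [NonUnitalCStarAlgebra A] [NonUnitalCStarAlgebra B]
  [NonUnitalCStarAlgebra C] [PartialOrder B] [StarOrderedRing B] [PartialOrder C]
  [StarOrderedRing C]
  {H : Type*} [NormedAddCommGroup H] [InnerProductSpace ℂ H] [CompleteSpace H]
  {K : Type*} [NormedAddCommGroup K] [InnerProductSpace ℂ K] [CompleteSpace K]

/-- A representation of `B` on a Hilbert space, as a correspondence from `B` to `ℂ`. -/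
def ofRep (σ : B →⋆ₙₐ[ℂ] (H →L[ℂ] H)) : Corr B ℂ where
  carrier := H
  ip := innerₛₗ ℂ
  rmul c := c • LinearMap.id
  star_ip x y := inner_conj_symm y x
  ip_self_nonneg x := by
    rw [innerₛₗ_apply_apply, inner_self_eq_norm_sq_to_K]
    exact pow_nonneg (Complex.zero_le_real.mpr (norm_nonneg x)) 2
  ip_rmul x y c := by
    rw [LinearMap.smul_apply, map_smul, smul_eq_mul, mul_comm]; rfl
  norm_sq x := by
    rw [innerₛₗ_apply_apply, inner_self_eq_norm_sq_to_K, norm_pow]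
    simp
  lmul := σ.toNonUnitalAlgHom
  ip_lmul a x y := by
    change inner ℂ (σ a x) y = inner ℂ x (σ (star a) y)
    rw [map_star, ContinuousLinearMap.star_eq_adjoint, ContinuousLinearMap.adjoint_inner_right]

/-- The Hilbert space `X ⊗_σ H`: the separated completion of the algebraic tensor product with
respect to `⟨x ⊗ h, y ⊗ k⟩ = ⟨h, σ(⟨x, y⟩) k⟩`. -/
abbrev IndSpace (X : Corr A B) (σ : B →⋆ₙₐ[ℂ] (H →L[ℂ] H)) : Type _ := X.tensor (ofRep σ)

/-- The elementary tensor `x ⊗ h`. -/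
def indTmul (X : Corr A B) (σ : B →⋆ₙₐ[ℂ] (H →L[ℂ] H)) (x : X) (h : H) : IndSpace X σ :=
  tmul X (ofRep σ) x h

theorem inner_indTmul (X : Corr A B) (σ : B →⋆ₙₐ[ℂ] (H →L[ℂ] H)) (x y : X) (h k : H) :
    inner ℂ (indTmul X σ x h) (indTmul X σ y k) = inner ℂ h (σ (X.ip x y) k) :=
  ip_tmul X (ofRep σ) x y h k

theorem indTmul_add (X : Corr A B) (σ : B →⋆ₙₐ[ℂ] (H →L[ℂ] H)) (x : X) (h k : H) :
    indTmul X σ x (h + k) = indTmul X σ x h + indTmul X σ x k :=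
  (congrArg (inc X (ofRep σ)) (TensorProduct.tmul_add x (h : ofRep σ) (k : ofRep σ))).trans
    (map_add _ _ _)

theorem indTmul_smul (X : Corr A B) (σ : B →⋆ₙₐ[ℂ] (H →L[ℂ] H)) (x : X) (c : ℂ) (h : H) :
    indTmul X σ x (c • h) = c • indTmul X σ x h :=
  (congrArg (inc X (ofRep σ)) ((TensorProduct.mk ℂ X (ofRep σ) x).map_smul c h)).trans
    (map_smul _ _ _)

theorem indTmul_zero (X : Corr A B) (σ : B →⋆ₙₐ[ℂ] (H →L[ℂ] H)) (x : X) :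
    indTmul X σ x 0 = 0 := by
  simpa using indTmul_smul X σ x 0 0

theorem norm_indTmul_sq_le (X : Corr A B) (σ : B →⋆ₙₐ[ℂ] (H →L[ℂ] H)) (x : X) (h : H) :
    ‖indTmul X σ x h‖ ^ 2 ≤ ‖x‖ ^ 2 * ‖h‖ ^ 2 := by
  have h1 : (‖indTmul X σ x h‖ ^ 2 : ℝ) = ‖inner ℂ h (σ (X.ip x x) h)‖ := by
    rw [← inner_indTmul, inner_self_eq_norm_sq_to_K]
    simp
  rw [h1]
  calc _ ≤ ‖h‖ * (‖X.ip x x‖ * ‖h‖) := by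
        refine (norm_inner_le_norm _ _).trans ?_
        gcongr
        refine (ContinuousLinearMap.le_opNorm _ _).trans ?_
        gcongr
        exact NonUnitalStarAlgHom.norm_apply_le σ _
    _ = _ := by rw [X.norm_sq]; ring

theorem continuous_indTmul (X : Corr A B) (σ : B →⋆ₙₐ[ℂ] (H →L[ℂ] H)) (x : X) :
    Continuous (indTmul X σ x) :=
  AddMonoidHomClass.continuous_of_bound
    (⟨⟨indTmul X σ x, indTmul_zero X σ x⟩, indTmul_add X σ x⟩ : H →+ IndSpace X σ) ‖x‖ fun h => by
      rw [← sq_le_sq₀ (norm_nonneg _) (by positivity), mul_pow]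
      exact norm_indTmul_sq_le X σ x h

/-- The representation of `A` on `X ⊗_σ H` induced by `σ`: `a ↦ φ(a) ⊗ 1`. -/
def indRep (X : Corr A B) (σ : B →⋆ₙₐ[ℂ] (H →L[ℂ] H)) :
    A →⋆ₙₐ[ℂ] (IndSpace X σ →L[ℂ] IndSpace X σ) where
  toNonUnitalAlgHom := (X.tensor (ofRep σ)).lmul
  map_star' a := by
    rw [ContinuousLinearMap.star_eq_adjoint, ContinuousLinearMap.eq_adjoint_iff]
    intro x y
    have := (X.tensor (ofRep σ)).ip_lmul (star a) x y
    rw [star_star] at this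
    exact this

theorem indRep_indTmul (X : Corr A B) (σ : B →⋆ₙₐ[ℂ] (H →L[ℂ] H)) (a : A) (x : X) (h : H) :
    indRep X σ a (indTmul X σ x h) = indTmul X σ (X.lmul a x) h :=
  lmul_tmul X (ofRep σ) a x h

theorem norm_sum_inner_self {ι : Type*} [Fintype ι] (v : ι → H) :
    ‖∑ k, inner ℂ (v k) (v k)‖ = ∑ k, ‖v k‖ ^ 2 := by
  simp_rw [inner_self_eq_norm_sq_to_K]
  norm_cast
  exact Real.norm_of_nonneg (by positivity)

section Ampliation

variable (X : Corr A B) (ρ : B →⋆ₙₐ[ℂ] (K →L[ℂ] K)) (σ : B →⋆ₙₐ[ℂ] (H →L[ℂ] H))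
  (t : K →L[ℂ] H)

/-- `1 ⊗ t` on the algebraic tensor product. -/
def preAmpl : X ⊗[ℂ] (ofRep ρ) →ₗ[ℂ] IndSpace X σ :=
  inc X (ofRep σ) ∘ₗ LinearMap.lTensor X (t.toLinearMap : ofRep ρ →ₗ[ℂ] ofRep σ)

theorem preAmpl_bound (ht : ∀ b, t ∘L ρ b = σ b ∘L t) (u : X ⊗[ℂ] (ofRep ρ)) :
    ‖preAmpl X ρ σ t u‖ ^ 2 ≤ ‖t‖ ^ 2 * ‖tensorForm X (ofRep ρ) u u‖ := by
  classical
  obtain ⟨S, rfl⟩ := exists_sum_tmul X (ofRep ρ) u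
  obtain ⟨s, hs⟩ := X.exists_factor_ip fun i : S => i.1.1
  have e1 : preAmpl X ρ σ t (∑ i : S, i.1.1 ⊗ₜ i.1.2)
      = inc X (ofRep σ) (∑ i : S, i.1.1 ⊗ₜ t i.1.2) := by
    rw [preAmpl, LinearMap.comp_apply, map_sum]
    rfl
  let v : S → K := fun k => ∑ i : S, ρ (s k i) i.1.2
  have e2 : tensorForm X (ofRep ρ) (∑ i : S, i.1.1 ⊗ₜ i.1.2) (∑ i : S, i.1.1 ⊗ₜ i.1.2)
      = ∑ k, inner ℂ (v k) (v k) := tensorForm_sum X (ofRep ρ) _ _ s hs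
  have e3 : tensorForm X (ofRep σ) (∑ i : S, i.1.1 ⊗ₜ t i.1.2) (∑ i : S, i.1.1 ⊗ₜ t i.1.2)
      = ∑ k, inner ℂ (t (v k)) (t (v k)) := by
    have : ∀ k, t (v k) = ∑ i : S, σ (s k i) (t i.1.2) := fun k => by
      rw [map_sum]
      exact Finset.sum_congr rfl fun i _ => DFunLike.congr_fun (ht _) _
    simp_rw [this]
    exact tensorForm_sum X (ofRep σ) _ _ s hs
  rw [e1, norm_inc_sq, e2, e3, norm_sum_inner_self, norm_sum_inner_self, Finset.mul_sum]
  refine Finset.sum_le_sum fun k _ => ?_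
  rw [← mul_pow]
  gcongr
  exact t.le_opNorm _

/-- The operator `I_X ⊗ t : X ⊗_ρ K → X ⊗_σ H`, for a bounded `t : K → H` that intertwines `ρ` and
`σ`; see `ampl_indTmul`. (For other `t` the value is of no interest.) -/
def ampl : IndSpace X ρ →L[ℂ] IndSpace X σ := lift X (ofRep ρ) (preAmpl X ρ σ t)

theorem ampl_indTmul (ht : ∀ b, t ∘L ρ b = σ b ∘L t) (x : X) (k : K) :
    ampl X ρ σ t (indTmul X ρ x k) = indTmul X σ x (t k) :=
  lift_inc X (ofRep ρ) (preAmpl X ρ σ t) ‖t‖ (norm_nonneg _) (preAmpl_bound X ρ σ t ht) (x ⊗ₜ k)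

end Ampliation

end Rep

/-- An isomorphism of C⋆-correspondences: a linear bijection that preserves the inner products and
both actions. -/
structure Iso {A : Type*} {B : Type*} [NonUnitalCStarAlgebra A] [NonUnitalCStarAlgebra B]
    [PartialOrder B] (X : Corr.{_, v, _} A B) (Y : Corr.{_, w, _} A B) where
  toLinearEquiv : X ≃ₗ[ℂ] Y
  map_ip : ∀ x y, Y.ip (toLinearEquiv x) (toLinearEquiv y) = X.ip x y
  map_lmul : ∀ a x, toLinearEquiv (X.lmul a x) = Y.lmul a (toLinearEquiv x)
  map_rmul : ∀ b x, toLinearEquiv (X.rmul b x) = Y.rmul b (toLinearEquiv x)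

section Rep

variable {A : Type*} {B : Type*} {C : Type*} [NonUnitalCStarAlgebra A] [NonUnitalCStarAlgebra B]
  [NonUnitalCStarAlgebra C] [PartialOrder B] [StarOrderedRing B] [PartialOrder C]
  [StarOrderedRing C]
  {H : Type*} [NormedAddCommGroup H] [InnerProductSpace ℂ H] [CompleteSpace H]

section IsoAmpl

variable {X : Corr.{_, v, _} A B} {Y : Corr.{_, w, _} A B} (W : Iso X Y)
  (σ : B →⋆ₙₐ[ℂ] (H →L[ℂ] H))

/-- `W ⊗ I_H` on the algebraic tensor product. -/
def preIsoAmpl : X ⊗[ℂ] (ofRep σ) →ₗ[ℂ] IndSpace Y σ :=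
  inc Y (ofRep σ) ∘ₗ LinearMap.rTensor (ofRep σ) W.toLinearEquiv.toLinearMap

theorem norm_preIsoAmpl_sq (u : X ⊗[ℂ] (ofRep σ)) :
    ‖preIsoAmpl W σ u‖ ^ 2 = ‖tensorForm X (ofRep σ) u u‖ := by
  have key : ∀ u v : X ⊗[ℂ] (ofRep σ),
      tensorForm Y (ofRep σ) (LinearMap.rTensor (ofRep σ) W.toLinearEquiv.toLinearMap u)
        (LinearMap.rTensor (ofRep σ) W.toLinearEquiv.toLinearMap v)
      = tensorForm X (ofRep σ) u v := by
    intro u v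
    induction u with
    | zero => simp
    | add u u' hu hu' => simp only [map_add, LinearMap.add_apply, hu, hu']
    | tmul x h =>
      induction v with
      | zero => simp
      | add v v' hv hv' => simp only [map_add, hv, hv']
      | tmul y k =>
        rw [LinearMap.rTensor_tmul, LinearMap.rTensor_tmul, tensorForm_tmul, tensorForm_tmul,
          LinearEquiv.coe_coe, W.map_ip]
  rw [preIsoAmpl, LinearMap.comp_apply, norm_inc_sq, key]

/-- The unitary `W ⊗ I_H : X ⊗_σ H → Y ⊗_σ H`. -/
def isoAmpl : IndSpace X σ ≃ₗᵢ[ℂ] IndSpace Y σ :=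
  LinearIsometryEquiv.ofSurjective
    (liftIsometry X (ofRep σ) (preIsoAmpl W σ) (norm_preIsoAmpl_sq W σ))
    (liftIsometry_surjective X (ofRep σ) _ _
      (by
        rw [DenseRange, preIsoAmpl, LinearMap.coe_comp, Set.range_comp,
          (LinearMap.rTensor_surjective (ofRep σ) W.toLinearEquiv.surjective).range_eq,
          Set.image_univ]
        exact denseRange_inc Y (ofRep σ)))

theorem isoAmpl_indTmul (x : X) (h : H) :
    isoAmpl W σ (indTmul X σ x h) = indTmul Y σ (W.toLinearEquiv x) h :=
  liftIsometry_inc X (ofRep σ) (preIsoAmpl W σ) (norm_preIsoAmpl_sq W σ) (x ⊗ₜ h)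

end IsoAmpl

section Assoc

variable (E : Corr.{_, v, _} A B) (X : Corr.{_, w, _} B C) (σ : C →⋆ₙₐ[ℂ] (H →L[ℂ] H))

/-- `e ⊗ x ↦ e ⊗ (x ⊗ h)` on the algebraic tensor product. -/
def preAssoc (h : H) : E ⊗[ℂ] X →ₗ[ℂ] IndSpace E (indRep X σ) :=
  inc E (ofRep (indRep X σ)) ∘ₗ LinearMap.lTensor E
    (inc X (ofRep σ) ∘ₗ (TensorProduct.mk ℂ X (ofRep σ)).flip h :
      X →ₗ[ℂ] ofRep (indRep X σ))

theorem preAssoc_tmul (h : H) (e : E) (x : X) :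
    preAssoc E X σ h (e ⊗ₜ x) = indTmul E (indRep X σ) e (indTmul X σ x h) := rfl

theorem inner_preAssoc (h k : H) (u v : E ⊗[ℂ] X) :
    inner ℂ (preAssoc E X σ h u) (preAssoc E X σ k v) = inner ℂ h (σ (tensorForm E X u v) k) := by
  induction u with
  | zero => simp
  | add u u' hu hu' =>
    simp only [map_add, LinearMap.add_apply, inner_add_left, hu, hu', add_apply, inner_add_right]
  | tmul e x =>
    induction v with
    | zero => simp
    | add v v' hv hv' => simp only [map_add, inner_add_right, hv, hv', add_apply]
    | tmul e' x' =>
      rw [preAssoc_tmul, preAssoc_tmul, inner_indTmul, indRep_indTmul, inner_indTmul,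
        tensorForm_tmul]

theorem norm_preAssoc_sq (h : H) (u : E ⊗[ℂ] X) :
    ‖preAssoc E X σ h u‖ ^ 2 ≤ ‖h‖ ^ 2 * ‖tensorForm E X u u‖ := by
  have h1 : (‖preAssoc E X σ h u‖ ^ 2 : ℝ) = ‖inner ℂ h (σ (tensorForm E X u u) h)‖ := by
    rw [← inner_preAssoc, inner_self_eq_norm_sq_to_K]
    simp
  rw [h1]
  calc _ ≤ ‖h‖ * (‖tensorForm E X u u‖ * ‖h‖) := by
        refine (norm_inner_le_norm _ _).trans ?_
        gcongr
        refine (ContinuousLinearMap.le_opNorm _ _).trans ?_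
        gcongr
        exact NonUnitalStarAlgHom.norm_apply_le σ _
    _ = _ := by ring

/-- `w ↦ e ⊗ (x ⊗ h)` for `w = e ⊗ x`. -/
def assocAux (h : H) : E.tensor X →L[ℂ] IndSpace E (indRep X σ) :=
  lift E X (preAssoc E X σ h)

theorem assocAux_inc (h : H) (u : E ⊗[ℂ] X) :
    assocAux E X σ h (inc E X u) = preAssoc E X σ h u :=
  lift_inc E X _ ‖h‖ (norm_nonneg _) (norm_preAssoc_sq E X σ h) u

theorem assocAux_tmul (h : H) (e : E) (x : X) :
    assocAux E X σ h (tmul E X e x) = indTmul E (indRep X σ) e (indTmul X σ x h) :=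
  assocAux_inc E X σ h (e ⊗ₜ x)

theorem inner_assocAux (h k : H) (w w' : E.tensor X) :
    inner ℂ (assocAux E X σ h w) (assocAux E X σ k w')
      = inner ℂ h (σ ((E.tensor X).ip w w') k) := by
  have hσ : Continuous σ := by
    have := NonUnitalStarAlgHom.norm_apply_le σ
    exact AddMonoidHomClass.continuous_of_bound σ 1 (by simpa using this)
  refine (denseRange_inc E X).induction_on₂ (isClosed_eq ?_ ?_) (fun u v => ?_) w w'
  · exact ((assocAux E X σ h).continuous.comp continuous_fst).inner
      ((assocAux E X σ k).continuous.comp continuous_snd)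
  · exact continuous_const.inner
      ((hσ.comp ((E.tensor X).continuous_ip continuous_fst continuous_snd)).clm_apply
        continuous_const)
  · rw [assocAux_inc, assocAux_inc, inner_preAssoc, ip_inc]

theorem assocAux_add (h h' : H) (w : E.tensor X) :
    assocAux E X σ (h + h') w = assocAux E X σ h w + assocAux E X σ h' w := by
  have : assocAux E X σ (h + h') = assocAux E X σ h + assocAux E X σ h' :=
    tensor_ext fun e x => by
      rw [add_apply, assocAux_tmul, assocAux_tmul, assocAux_tmul, indTmul_add, indTmul_add]
  rw [this, add_apply]

theorem assocAux_smul (c : ℂ) (h : H) (w : E.tensor X) :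
    assocAux E X σ (c • h) w = c • assocAux E X σ h w := by
  have : assocAux E X σ (c • h) = c • assocAux E X σ h :=
    tensor_ext fun e x => by
      rw [smul_apply, assocAux_tmul, assocAux_tmul, indTmul_smul, indTmul_smul]
  rw [this, smul_apply]

/-- `(e ⊗ x) ⊗ h ↦ e ⊗ (x ⊗ h)`, on the algebraic tensor product of `E ⊗ X` and `H` -/
def assocLin : (E.tensor X) ⊗[ℂ] (ofRep σ) →ₗ[ℂ] IndSpace E (indRep X σ) :=
  TensorProduct.lift <| LinearMap.mk₂ ℂ (fun (w : E.tensor X) (h : ofRep σ) => assocAux E X σ h w)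
    (fun _ _ _ => map_add _ _ _) (fun _ _ _ => map_smul _ _ _)
    (fun w h h' => assocAux_add E X σ h h' w) (fun c w h => assocAux_smul E X σ c h w)

theorem norm_assocLin_sq (u : (E.tensor X) ⊗[ℂ] (ofRep σ)) :
    ‖assocLin E X σ u‖ ^ 2 = ‖tensorForm (E.tensor X) (ofRep σ) u u‖ := by
  have key : ∀ u v : (E.tensor X) ⊗[ℂ] (ofRep σ),
      inner ℂ (assocLin E X σ u) (assocLin E X σ v) = tensorForm (E.tensor X) (ofRep σ) u v := by
    intro u v
    induction u with
    | zero => simp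
    | add u u' hu hu' => simp only [map_add, LinearMap.add_apply, inner_add_left, hu, hu']
    | tmul x h =>
      induction v with
      | zero => simp
      | add v v' hv hv' => simp only [map_add, inner_add_right, hv, hv']
      | tmul y k => exact inner_assocAux E X σ h k x y
  rw [← key, inner_self_eq_norm_sq_to_K]
  simp

theorem denseRange_assocLin : DenseRange (assocLin E X σ) := by
  have hrange : ∀ e x h, indTmul E (indRep X σ) e (indTmul X σ x h)
      ∈ (LinearMap.range (assocLin E X σ)).topologicalClosure := fun e x h =>
    Submodule.le_topologicalClosure _ ⟨tmul E X e x ⊗ₜ h, assocAux_tmul E X σ h e x⟩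
  set S := (LinearMap.range (assocLin E X σ)).topologicalClosure with hS
  have hclosed : IsClosed (S : Set (IndSpace E (indRep X σ))) :=
    Submodule.isClosed_topologicalClosure _
  have h1 : ∀ (e : E) (g : IndSpace X σ), indTmul E (indRep X σ) e g ∈ S := fun e g => by
    refine (denseRange_inc X (ofRep σ)).induction_on g
      (hclosed.preimage (continuous_indTmul E (indRep X σ) e)) fun u => ?_
    induction u with
    | zero => rw [map_zero, indTmul_zero]; exact S.zero_mem
    | add u u' hu hu' => rw [map_add, indTmul_add]; exact S.add_mem hu hu'
    | tmul x h => exact hrange e x h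
  have h2 : ∀ g : IndSpace E (indRep X σ), g ∈ S := fun g => by
    refine (denseRange_inc E (ofRep (indRep X σ))).induction_on g hclosed fun u => ?_
    induction u with
    | zero => rw [map_zero]; exact S.zero_mem
    | add u u' hu hu' => rw [map_add]; exact S.add_mem hu hu'
    | tmul e g => exact h1 e g
  intro g
  exact h2 g

/-- The unitary `(E ⊗ X) ⊗_σ H → E ⊗ (X ⊗_σ H)`, `(e ⊗ x) ⊗ h ↦ e ⊗ (x ⊗ h)`. -/
def assoc : IndSpace (E.tensor X) σ ≃ₗᵢ[ℂ] IndSpace E (indRep X σ) :=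
  LinearIsometryEquiv.ofSurjective
    (liftIsometry (E.tensor X) (ofRep σ) (assocLin E X σ) (norm_assocLin_sq E X σ))
    (liftIsometry_surjective (E.tensor X) (ofRep σ) _ _ (denseRange_assocLin E X σ))

theorem assoc_indTmul (e : E) (x : X) (h : H) :
    assoc E X σ (indTmul (E.tensor X) σ (tmul E X e x) h)
      = indTmul E (indRep X σ) e (indTmul X σ x h) :=
  (liftIsometry_inc (E.tensor X) (ofRep σ) (assocLin E X σ) (norm_assocLin_sq E X σ)
    (tmul E X e x ⊗ₜ h)).trans (assocAux_tmul E X σ h e x)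

end Assoc

end Rep

end Corr

/-- An equivalence (imprimitivity) bimodule between `M` and `N`: a right Hilbert `N`-module with a
left action of `M` by adjointable operators and an `M`-valued inner product `lip`, linear in the
first variable, for which `N` acts by adjointable operators, such that
`⟨x, y⟩_M z = x ⟨y, z⟩_N`, and such that both inner products are full. Definiteness and completeness
on the left follow from `‖⟨x, x⟩_M‖ = ‖⟨x, x⟩_N‖`, a consequence of the axioms. -/
structure EquivBimodule (M : Type w) (N : Type u) [NonUnitalCStarAlgebra M]
    [NonUnitalCStarAlgebra N] [PartialOrder M] [PartialOrder N] extends Corr.{u, v, w} M N where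
  lip : carrier →ₗ[ℂ] carrier →ₗ⋆[ℂ] M
  star_lip : ∀ x y, star (lip x y) = lip y x
  lip_self_nonneg : ∀ x, 0 ≤ lip x x
  lip_lmul : ∀ a x y, lip (lmul a x) y = a * lip x y
  lip_rmul : ∀ b x y, lip (rmul b x) y = lip x (rmul (star b) y)
  lmul_lip : ∀ x y z, lmul (lip x y) z = rmul (ip y z) x
  lip_full : Dense (Submodule.span ℂ {a | ∃ x y, lip x y = a} : Set M)
  ip_full : Dense (Submodule.span ℂ {b | ∃ x y, ip x y = b} : Set N)

section Morita

variable {M : Type*} {N : Type*} [NonUnitalCStarAlgebra M] [NonUnitalCStarAlgebra N]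
  [PartialOrder M] [StarOrderedRing M] [PartialOrder N] [StarOrderedRing N]
  {H : Type*} [NormedAddCommGroup H] [InnerProductSpace ℂ H] [CompleteSpace H]

/-- The representation `σ` is nondegenerate: `σ(N) H` spans a dense subspace of `H`. -/
def RepNondegenerate (σ : N →⋆ₙₐ[ℂ] (H →L[ℂ] H)) : Prop :=
  Dense (Submodule.span ℂ {k | ∃ b h, σ b h = k} : Set H)

/-- The left action on `F` is nondegenerate: `φ(A) F` spans a dense subspace of `F`. -/
def Corr.LeftNondegenerate {A : Type*} [NonUnitalCStarAlgebra A] (F : Corr A N) : Prop :=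
  Dense (Submodule.span ℂ {y | ∃ (a : A) (x : F), F.lmul a x = y} : Set F)

open Corr

/-- The `σ`-dual `F^σ`: the bounded operators `z : H → F ⊗_σ H` with `z σ(b) = (φ(b) ⊗ I) z`. -/
def sigmaDual (F : Corr N N) (σ : N →⋆ₙₐ[ℂ] (H →L[ℂ] H)) : Set (H →L[ℂ] IndSpace F σ) :=
  {z | ∀ b, z ∘L σ b = indRep F σ b ∘L z}

/-- The space `F^{σ*}` of the adjoints `z*`, `z ∈ F^σ`. -/
def sigmaDualStar (F : Corr N N) (σ : N →⋆ₙₐ[ℂ] (H →L[ℂ] H)) : Set (IndSpace F σ →L[ℂ] H) :=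
  {t | ∃ z ∈ sigmaDual F σ, t = ContinuousLinearMap.adjoint z}

/-- The closed unit ball of `F^{σ*}`, in the operator norm. -/
def closedDisc (F : Corr N N) (σ : N →⋆ₙₐ[ℂ] (H →L[ℂ] H)) : Set (IndSpace F σ →L[ℂ] H) :=
  {t | t ∈ sigmaDualStar F σ ∧ ‖t‖ ≤ 1}

theorem sigmaDualStar_intertwines {F : Corr N N} {σ : N →⋆ₙₐ[ℂ] (H →L[ℂ] H)}
    {t : IndSpace F σ →L[ℂ] H} (ht : t ∈ sigmaDualStar F σ) (b : N) :
    t ∘L indRep F σ b = σ b ∘L t := by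
  obtain ⟨z, hz, rfl⟩ := ht
  have h := congrArg ContinuousLinearMap.adjoint (hz (star b))
  rw [ContinuousLinearMap.adjoint_comp, ContinuousLinearMap.adjoint_comp, map_star σ b,
    map_star (indRep F σ) b,
    ContinuousLinearMap.star_eq_adjoint, ContinuousLinearMap.star_eq_adjoint,
    ContinuousLinearMap.adjoint_adjoint, ContinuousLinearMap.adjoint_adjoint] at h
  exact h.symm

section Transform

variable {E : Corr M M} {F : Corr N N} (X : Corr M N)
  (W : Iso (E.tensor X) (X.tensor F)) (σ : N →⋆ₙₐ[ℂ] (H →L[ℂ] H))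

/-- The unitary `W ⊗ I_H : E ⊗ (X ⊗_σ H) → X ⊗ (F ⊗_σ H)`, where `E ⊗ (X ⊗_σ H)` is identified with
`(E ⊗ X) ⊗_σ H` and `(X ⊗ F) ⊗_σ H` with `X ⊗ (F ⊗_σ H)`. -/
def tensorUnitary : IndSpace E (indRep X σ) ≃ₗᵢ[ℂ] IndSpace X (indRep F σ) :=
  ((assoc E X σ).symm.trans (isoAmpl W σ)).trans (assoc X F σ)

/-- The map `z* ↦ (I_X ⊗ z*) (W ⊗ I_H)`. -/
def moritaTransform (t : IndSpace F σ →L[ℂ] H) : IndSpace E (indRep X σ) →L[ℂ] IndSpace X σ :=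
  ampl X (indRep F σ) σ t ∘L
    (tensorUnitary X W σ : IndSpace E (indRep X σ) →L[ℂ] IndSpace X (indRep F σ))

end Transform

end Morita

end CStarMorita

end

/-!
The unitary `W ⊗ I_H` carries the induced representation of `M` on `E ⊗ (X ⊗_σ H)` to that on
`X ⊗ (F ⊗_σ H)`, so the theorem is about `t ↦ I_X ⊗ t`, from the operators `t : K → H` that
intertwine two representations `ρ`, `σ` of `N` to the operators `X ⊗_ρ K → X ⊗_σ H` that intertwine
the induced representations of `M`, for `K = F ⊗_σ H`.

Let `T_x : h ↦ x ⊗ h`. Then `T_x^* T_y` is the action of `⟨x, y⟩_N` and `T_x T_y^*` is the action of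
`⟨x, y⟩_M`. Hence the length of a sum `∑ T_{xᵢ}^* wᵢ` depends only on the `wᵢ` and the
representation of `M`: factor the positive matrix `⟨xᵢ, xⱼ⟩_M` as `s* s`
(`EquivBimodule.norm_sum_annih_sq`). For an intertwiner `s` of the representations of `M`, the rule
`T_x^* w ↦ T_x^* s w` is therefore well defined and bounded by `‖s‖`; extended by zero to the
orthogonal complement it gives an intertwiner `t` with `I_X ⊗ t = s` and `‖t‖ ≤ ‖s‖`
(`EquivBimodule.exists_ampl_eq`). This is surjectivity. For the isometry, apply it to `s = I_X ⊗ t`: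
the result `r` agrees with `t` after multiplication by any `σ(b)`, as `⟨·, ·⟩_N` is full, and
therefore, by intertwining, also before any `ρ(b)`. If `σ` or the left action on `F` is
nondegenerate, it follows that `r = t`, so `‖t‖ ≤ ‖I_X ⊗ t‖` (`EquivBimodule.norm_ampl`).
-/

noncomputable section

namespace CStarMorita

/-! ### Extension of a dominated linear map -/

section Extension

variable {U : Type*} [AddCommGroup U] [Module ℂ U]
  {H : Type*} [NormedAddCommGroup H] [InnerProductSpace ℂ H] [CompleteSpace H]
  {K : Type*} [NormedAddCommGroup K] [InnerProductSpace ℂ K] [CompleteSpace K]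

/-- A linear map `g` dominated by `f` factors through `f` by a bounded operator that vanishes on the
orthogonal complement of the range of `f`. -/
theorem exists_clm_comp_eq (f : U →ₗ[ℂ] K) (g : U →ₗ[ℂ] H) {C : ℝ} (hC : 0 ≤ C)
    (h : ∀ u, ‖g u‖ ≤ C * ‖f u‖) :
    ∃ t : K →L[ℂ] H, ‖t‖ ≤ C ∧ (∀ u, t (f u) = g u) ∧
      ∀ k ∈ (LinearMap.range f)ᗮ, t k = 0 := by
  -- extend `g ∘ f⁻¹` from the range of `f` to its closure, then project
  set S := (LinearMap.range f).topologicalClosure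
  have hfS : ∀ u, f u ∈ S := fun u => Submodule.le_topologicalClosure _ ⟨u, rfl⟩
  let e : U →ₗ[ℂ] S := f.codRestrict S hfS
  have he : DenseRange e := by
    intro x
    rw [closure_subtype, ← Set.range_comp]
    exact x.2
  have : CompleteSpace S := (Submodule.isClosed_topologicalClosure _).completeSpace_coe
  refine ⟨g.extendOfNorm e ∘L S.orthogonalProjectionOnto, ?_, fun u => ?_, fun k hk => ?_⟩
  · refine (ContinuousLinearMap.opNorm_comp_le _ _).trans ?_
    have h1 := LinearMap.opNorm_extendOfNorm_le he hC h
    have h2 := S.orthogonalProjectionOnto_norm_le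
    nlinarith [norm_nonneg (S.orthogonalProjectionOnto), norm_nonneg (g.extendOfNorm e)]
  · have : S.orthogonalProjectionOnto (f u) = e u :=
      S.orthogonalProjectionOnto_mem_subspace_eq_self (e u)
    rw [ContinuousLinearMap.comp_apply, this, LinearMap.extendOfNorm_eq he ⟨C, h⟩]
  · rw [← Submodule.orthogonal_closure] at hk
    rw [ContinuousLinearMap.comp_apply,
      Submodule.orthogonalProjectionOnto_apply_of_mem_orthogonal hk, map_zero]

end Extension

namespace Corr

variable {A : Type*} {B : Type*} {C : Type*} [NonUnitalCStarAlgebra A] [NonUnitalCStarAlgebra B]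
  [NonUnitalCStarAlgebra C] [PartialOrder B] [StarOrderedRing B] [PartialOrder C]
  [StarOrderedRing C]
  {H : Type*} [NormedAddCommGroup H] [InnerProductSpace ℂ H] [CompleteSpace H]
  {K : Type*} [NormedAddCommGroup K] [InnerProductSpace ℂ K] [CompleteSpace K]

/-! ### Creation and annihilation operators -/

section Creation

variable (X : Corr A B) (σ : B →⋆ₙₐ[ℂ] (H →L[ℂ] H))

theorem add_indTmul (x y : X) (h : H) :
    indTmul X σ (x + y) h = indTmul X σ x h + indTmul X σ y h :=
  (congrArg (inc X (ofRep σ)) (TensorProduct.add_tmul x y (h : ofRep σ))).trans (map_add _ _ _)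

theorem smul_indTmul (c : ℂ) (x : X) (h : H) :
    indTmul X σ (c • x) h = c • indTmul X σ x h :=
  (congrArg (inc X (ofRep σ)) (TensorProduct.smul_tmul' c x (h : ofRep σ)).symm).trans
    (map_smul _ _ _)

theorem norm_indTmul_le (x : X) (h : H) : ‖indTmul X σ x h‖ ≤ ‖x‖ * ‖h‖ := by
  rw [← sq_le_sq₀ (norm_nonneg _) (by positivity), mul_pow]
  exact norm_indTmul_sq_le X σ x h

/-- The bounded bilinear map `(x, h) ↦ x ⊗ h`. -/
def indTmulL : X →L[ℂ] H →L[ℂ] IndSpace X σ :=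
  LinearMap.mkContinuous₂ (LinearMap.mk₂ ℂ (indTmul X σ) (add_indTmul X σ) (smul_indTmul X σ)
    (indTmul_add X σ) (fun c x h => indTmul_smul X σ x c h)) 1 fun x h => by
      rw [one_mul]; exact norm_indTmul_le X σ x h

@[simp]
theorem indTmulL_apply (x : X) (h : H) : indTmulL X σ x h = indTmul X σ x h := rfl

variable {X σ} in
theorem ind_ext {Z : Type*} [NormedAddCommGroup Z] [NormedSpace ℂ Z]
    {f g : IndSpace X σ →L[ℂ] Z} (h : ∀ x k, f (indTmul X σ x k) = g (indTmul X σ x k)) : f = g :=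
  tensor_ext h

/-- The annihilation operator `T_x^*`, adjoint to the creation operator `T_x : h ↦ x ⊗ h`. -/
def annih (x : X) : IndSpace X σ →L[ℂ] H := ContinuousLinearMap.adjoint (indTmulL X σ x)

theorem inner_annih_right (x : X) (h : H) (w : IndSpace X σ) :
    inner ℂ h (annih X σ x w) = inner ℂ (indTmul X σ x h) w :=
  ContinuousLinearMap.adjoint_inner_right _ _ _

theorem inner_annih_left (x : X) (h : H) (w : IndSpace X σ) :
    inner ℂ (annih X σ x w) h = inner ℂ w (indTmul X σ x h) :=
  ContinuousLinearMap.adjoint_inner_left _ _ _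

theorem annih_indTmul (x y : X) (h : H) : annih X σ x (indTmul X σ y h) = σ (X.ip x y) h :=
  ext_inner_left ℂ fun k => by rw [inner_annih_right, inner_indTmul]

variable {X σ} in
/-- The annihilation operators separate the points of `X ⊗_σ H`. -/
theorem ext_annih {v w : IndSpace X σ} (h : ∀ x, annih X σ x v = annih X σ x w) : v = w := by
  have : innerSL ℂ v = innerSL ℂ w := ind_ext fun x k => by
    rw [innerSL_apply_apply, innerSL_apply_apply, ← inner_annih_left, ← inner_annih_left, h]
  exact innerSL_inj.mp this

theorem indTmul_rmul (b : B) (x : X) (h : H) :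
    indTmul X σ (X.rmul b x) h = indTmul X σ x (σ b h) :=
  ext_annih fun y => by
    rw [annih_indTmul, annih_indTmul, X.ip_rmul, map_mul, mul_apply_eq_comp]

theorem annih_rmul (b : B) (x : X) (w : IndSpace X σ) :
    annih X σ (X.rmul (star b) x) w = σ b (annih X σ x w) :=
  ext_inner_left ℂ fun h => by
    rw [inner_annih_right, indTmul_rmul, ← inner_annih_right, map_star,
      ContinuousLinearMap.star_eq_adjoint, ContinuousLinearMap.adjoint_inner_left]

end Creation

/-! ### Intertwiners and the induced representations -/

theorem norm_ampl_le (X : Corr A B) (ρ : B →⋆ₙₐ[ℂ] (K →L[ℂ] K)) (σ : B →⋆ₙₐ[ℂ] (H →L[ℂ] H))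
    (t : K →L[ℂ] H) (ht : ∀ b, t ∘L ρ b = σ b ∘L t) : ‖ampl X ρ σ t‖ ≤ ‖t‖ :=
  LinearMap.opNorm_extendOfNorm_le (denseRange_inc X (ofRep ρ)) (norm_nonneg _)
    ((preTensor X (ofRep ρ)).exists_bound_of_sq _ ‖t‖ (norm_nonneg _) (preAmpl_bound X ρ σ t ht))

theorem ampl_comp_indRep (X : Corr A B) (ρ : B →⋆ₙₐ[ℂ] (K →L[ℂ] K)) (σ : B →⋆ₙₐ[ℂ] (H →L[ℂ] H))
    (t : K →L[ℂ] H) (ht : ∀ b, t ∘L ρ b = σ b ∘L t) (a : A) :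
    ampl X ρ σ t ∘L indRep X ρ a = indRep X σ a ∘L ampl X ρ σ t :=
  ind_ext fun x k => by
    simp only [ContinuousLinearMap.comp_apply, indRep_indTmul, ampl_indTmul X ρ σ t ht]

theorem ampl_sub (X : Corr A B) (ρ : B →⋆ₙₐ[ℂ] (K →L[ℂ] K)) (σ : B →⋆ₙₐ[ℂ] (H →L[ℂ] H))
    (s t : K →L[ℂ] H) (hs : ∀ b, s ∘L ρ b = σ b ∘L s) (ht : ∀ b, t ∘L ρ b = σ b ∘L t) :
    ampl X ρ σ (s - t) = ampl X ρ σ s - ampl X ρ σ t :=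
  have hst : ∀ b, (s - t) ∘L ρ b = σ b ∘L (s - t) := fun b => by
    rw [ContinuousLinearMap.sub_comp, ContinuousLinearMap.comp_sub, hs, ht]
  ind_ext fun x k => by
    rw [sub_apply, ampl_indTmul X ρ σ _ hst, ampl_indTmul X ρ σ _ hs, ampl_indTmul X ρ σ _ ht,
      sub_apply, ← indTmulL_apply, map_sub]
    rfl

theorem assoc_indRep (E : Corr A B) (X : Corr B C) (σ : C →⋆ₙₐ[ℂ] (H →L[ℂ] H)) (a : A)
    (w : IndSpace (E.tensor X) σ) :
    assoc E X σ (indRep (E.tensor X) σ a w) = indRep E (indRep X σ) a (assoc E X σ w) := by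
  let S : IndSpace (E.tensor X) σ →L[ℂ] IndSpace E (indRep X σ) := assoc E X σ
  have : S ∘L indRep (E.tensor X) σ a = indRep E (indRep X σ) a ∘L S := ind_ext fun u h => by
    have : (S ∘L indRep (E.tensor X) σ a) ∘L (indTmulL (E.tensor X) σ).flip h
        = (indRep E (indRep X σ) a ∘L S) ∘L (indTmulL (E.tensor X) σ).flip h :=
      tensor_ext fun e x => by
        change assoc E X σ (indRep _ σ a (indTmul _ σ _ h))
          = indRep E (indRep X σ) a (assoc E X σ (indTmul _ σ _ h))
        rw [indRep_indTmul, lmul_tmul, assoc_indTmul, assoc_indTmul, indRep_indTmul]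
    exact DFunLike.congr_fun this u
  exact DFunLike.congr_fun this w

theorem isoAmpl_indRep {X Y : Corr A B} (W : Iso X Y) (σ : B →⋆ₙₐ[ℂ] (H →L[ℂ] H)) (a : A)
    (w : IndSpace X σ) : isoAmpl W σ (indRep X σ a w) = indRep Y σ a (isoAmpl W σ w) := by
  let S : IndSpace X σ →L[ℂ] IndSpace Y σ := isoAmpl W σ
  have : S ∘L indRep X σ a = indRep Y σ a ∘L S := ind_ext fun x h => by
    change isoAmpl W σ (indRep X σ a (indTmul X σ x h))
      = indRep Y σ a (isoAmpl W σ (indTmul X σ x h))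
    rw [indRep_indTmul, isoAmpl_indTmul, isoAmpl_indTmul, indRep_indTmul, W.map_lmul]
  exact DFunLike.congr_fun this w

/-- If the left action on `F` is nondegenerate, an operator that kills all `(φ(a) ⊗ 1) w` is zero:
the vectors `φ(a) x ⊗ h` are total in `F ⊗_σ H`. -/
theorem LeftNondegenerate.eq_zero_of_comp_indRep {F : Corr A B} (hF : F.LeftNondegenerate)
    (σ : B →⋆ₙₐ[ℂ] (H →L[ℂ] H)) {Z : Type*} [NormedAddCommGroup Z] [NormedSpace ℂ Z]
    {d : IndSpace F σ →L[ℂ] Z} (hd : ∀ a, d ∘L indRep F σ a = 0) :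
    d = 0 :=
  ind_ext fun x h => by
    have : d ∘L (indTmulL F σ).flip h = 0 := by
      refine ContinuousLinearMap.ext_on hF ?_
      rintro _ ⟨a, x, rfl⟩
      change d (indTmul F σ (F.lmul a x) h) = 0
      rw [← indRep_indTmul]
      exact DFunLike.congr_fun (hd a) _
    exact DFunLike.congr_fun this x

end Corr

theorem RepNondegenerate.eq_zero_of_comp {N : Type*} [NonUnitalCStarAlgebra N] {H K : Type*}
    [NormedAddCommGroup H] [InnerProductSpace ℂ H] [CompleteSpace H]
    [NormedAddCommGroup K] [InnerProductSpace ℂ K] [CompleteSpace K]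
    {σ : N →⋆ₙₐ[ℂ] (H →L[ℂ] H)} (hσ : RepNondegenerate σ) {d : K →L[ℂ] H}
    (hd : ∀ b, σ b ∘L d = 0) : d = 0 := by
  have : ContinuousLinearMap.adjoint d = 0 := by
    refine ContinuousLinearMap.ext_on hσ ?_
    rintro _ ⟨b, h, rfl⟩
    have h1 := congrArg ContinuousLinearMap.adjoint (hd (star b))
    rw [ContinuousLinearMap.adjoint_comp, map_zero, map_star, ContinuousLinearMap.star_eq_adjoint,
      ContinuousLinearMap.adjoint_adjoint] at h1
    exact DFunLike.congr_fun h1 h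
  rw [← ContinuousLinearMap.adjoint_adjoint d, this, map_zero]

/-! ### Equivalence bimodules and descent of intertwiners -/

namespace EquivBimodule

open Corr

variable {M : Type*} {N : Type*} [NonUnitalCStarAlgebra M] [NonUnitalCStarAlgebra N]
  [PartialOrder M] [PartialOrder N]
  {H : Type*} [NormedAddCommGroup H] [InnerProductSpace ℂ H] [CompleteSpace H]
  {K : Type*} [NormedAddCommGroup K] [InnerProductSpace ℂ K] [CompleteSpace K]
  (X : EquivBimodule M N)

theorem lip_lmul_right (a : M) (x y : X.carrier) : X.lip x (X.lmul a y) = X.lip x y * star a := by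
  rw [← X.star_lip, X.lip_lmul, star_mul, X.star_lip]

/-- For finitely many `xᵢ` there is a matrix `s` over `M` with `⟨xᵢ, xⱼ⟩_M = ∑ₖ sₖᵢ* sₖⱼ`. -/
theorem exists_factor_lip [StarOrderedRing M] {ι : Type*} [Fintype ι] [DecidableEq ι]
    (x : ι → X.carrier) :
    ∃ s : ι → ι → M, ∀ i j, X.lip (x i) (x j) = ∑ k, star (s k i) * s k j := by
  refine exists_factor _ (fun i j => X.star_lip _ _) fun w => ?_
  have h := X.lip_self_nonneg (∑ i, X.lmul (star (w i)) (x i))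
  convert h using 1
  simp only [map_sum, LinearMap.sum_apply, X.lip_lmul, X.lip_lmul_right, star_star, mul_assoc]
  exact Finset.sum_comm

variable [StarOrderedRing N]

/-- A vector killed by all `σ(⟨x, y⟩_N)` is killed by `σ(N)`, as the inner product is full. -/
theorem rep_apply_eq_zero (σ : N →⋆ₙₐ[ℂ] (H →L[ℂ] H)) {h : H} (hh : ∀ x y, σ (X.ip x y) h = 0)
    (b : N) : σ b h = 0 := by
  let f : N →L[ℂ] H := LinearMap.mkContinuous
    { toFun := fun b => σ b h
      map_add' := fun a b => by rw [map_add, add_apply]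
      map_smul' := fun c b => by rw [map_smul]; rfl } ‖h‖ fun b => by
    rw [mul_comm]
    refine ((σ b).le_opNorm h).trans ?_
    gcongr
    exact NonUnitalStarAlgHom.norm_apply_le σ b
  have : f = 0 := by
    refine ContinuousLinearMap.ext_on X.ip_full ?_
    rintro _ ⟨x, y, rfl⟩
    exact hh x y
  exact DFunLike.congr_fun this b

/-- `T_x T_y^*` is the action of `⟨x, y⟩_M`. -/
theorem indTmul_annih (σ : N →⋆ₙₐ[ℂ] (H →L[ℂ] H)) (x y : X.carrier) (w : IndSpace X.toCorr σ) :
    indTmul X.toCorr σ x (annih X.toCorr σ y w) = indRep X.toCorr σ (X.lip x y) w := by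
  have : indTmulL X.toCorr σ x ∘L annih X.toCorr σ y = indRep X.toCorr σ (X.lip x y) :=
    ind_ext fun z h => by
      rw [ContinuousLinearMap.comp_apply, annih_indTmul, indTmulL_apply, indRep_indTmul,
        X.lmul_lip, indTmul_rmul]
  exact DFunLike.congr_fun this w

/-- The squared length of `∑ T_{xᵢ}^* wᵢ`, expressed by the representation of `M` alone: it is
`∑ ⟨wᵢ, π(⟨xᵢ, xⱼ⟩_M) wⱼ⟩`, with `π` the induced representation. -/
theorem norm_sum_annih_sq (σ : N →⋆ₙₐ[ℂ] (H →L[ℂ] H)) {ι : Type*} [Fintype ι]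
    (x : ι → X.carrier) (w : ι → IndSpace X.toCorr σ) (s : ι → ι → M)
    (hs : ∀ i j, X.lip (x i) (x j) = ∑ k, star (s k i) * s k j) :
    ‖∑ i, annih X.toCorr σ (x i) (w i)‖ ^ 2
      = ∑ k, ‖∑ i, indRep X.toCorr σ (s k i) (w i)‖ ^ 2 := by
  have h1 : ∀ a v v', inner ℂ (indRep X.toCorr σ a v) v'
      = inner ℂ v (indRep X.toCorr σ (star a) v') := fun a v v' => by
    rw [map_star, ContinuousLinearMap.star_eq_adjoint, ContinuousLinearMap.adjoint_inner_right]
  have key : inner ℂ (∑ i, annih X.toCorr σ (x i) (w i)) (∑ i, annih X.toCorr σ (x i) (w i))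
      = ∑ k, inner ℂ (∑ i, indRep X.toCorr σ (s k i) (w i))
          (∑ i, indRep X.toCorr σ (s k i) (w i)) := by
    simp only [sum_inner, inner_sum, inner_annih_left, indTmul_annih, hs, map_sum, sum_apply,
      map_mul, mul_apply_eq_comp, h1]
    conv_rhs => rw [Finset.sum_comm]
    refine Finset.sum_congr rfl fun i _ => ?_
    rw [Finset.sum_comm]
  rw [← norm_sum_inner_self, ← key, inner_self_eq_norm_sq_to_K]
  simp

variable (ρ : N →⋆ₙₐ[ℂ] (K →L[ℂ] K)) (σ : N →⋆ₙₐ[ℂ] (H →L[ℂ] H))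

variable {ρ σ} in
/-- Intertwiners with the same image under `t ↦ I_X ⊗ t` differ at most by an operator into the
degenerate part of `σ`. -/
theorem rep_comp_eq_of_ampl_eq {s t : K →L[ℂ] H} (hs : ∀ b, s ∘L ρ b = σ b ∘L s)
    (ht : ∀ b, t ∘L ρ b = σ b ∘L t) (h : ampl X.toCorr ρ σ s = ampl X.toCorr ρ σ t) (b : N) :
    σ b ∘L s = σ b ∘L t := by
  ext k
  rw [ContinuousLinearMap.comp_apply, ContinuousLinearMap.comp_apply, ← sub_eq_zero, ← map_sub]
  refine X.rep_apply_eq_zero σ (fun x y => ?_) b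
  rw [map_sub, sub_eq_zero, ← annih_indTmul, ← annih_indTmul, ← ampl_indTmul X.toCorr ρ σ s hs,
    ← ampl_indTmul X.toCorr ρ σ t ht, h]

variable [StarOrderedRing M]

/-- An operator that intertwines the representations of `M` is bounded on the sums
`∑ T_{xᵢ}^* wᵢ`. -/
theorem norm_sum_annih_map_le (s : IndSpace X.toCorr ρ →L[ℂ] IndSpace X.toCorr σ)
    (hs : ∀ a, s ∘L indRep X.toCorr ρ a = indRep X.toCorr σ a ∘L s) {ι : Type*} [Fintype ι]
    (x : ι → X.carrier) (w : ι → IndSpace X.toCorr ρ) :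
    ‖∑ i, annih X.toCorr σ (x i) (s (w i))‖ ≤ ‖s‖ * ‖∑ i, annih X.toCorr ρ (x i) (w i)‖ := by
  classical
  obtain ⟨m, hm⟩ := X.exists_factor_lip x
  rw [← sq_le_sq₀ (norm_nonneg _) (by positivity), mul_pow, X.norm_sum_annih_sq σ x _ m hm,
    X.norm_sum_annih_sq ρ x _ m hm, Finset.mul_sum]
  refine Finset.sum_le_sum fun k _ => ?_
  have : ∑ i, indRep X.toCorr σ (m k i) (s (w i)) = s (∑ i, indRep X.toCorr ρ (m k i) (w i)) := by
    rw [map_sum]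
    exact Finset.sum_congr rfl fun i _ => (DFunLike.congr_fun (hs _) _).symm
  rw [this, ← mul_pow]
  gcongr
  exact s.le_opNorm _

/-- Every intertwiner of the induced representations of `M` is of the form `I_X ⊗ t`, where `t`
intertwines the representations of `N` and has no larger norm. -/
theorem exists_ampl_eq (s : IndSpace X.toCorr ρ →L[ℂ] IndSpace X.toCorr σ)
    (hs : ∀ a, s ∘L indRep X.toCorr ρ a = indRep X.toCorr σ a ∘L s) :
    ∃ t : K →L[ℂ] H, (∀ b, t ∘L ρ b = σ b ∘L t) ∧ ‖t‖ ≤ ‖s‖ ∧ ampl X.toCorr ρ σ t = s := by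
  let f : (X.carrier →₀ IndSpace X.toCorr ρ) →ₗ[ℂ] K :=
    Finsupp.lsum ℂ fun x => (annih X.toCorr ρ x).toLinearMap
  let g : (X.carrier →₀ IndSpace X.toCorr ρ) →ₗ[ℂ] H :=
    Finsupp.lsum ℂ fun x => (annih X.toCorr σ x ∘L s).toLinearMap
  have hfg : ∀ u, ‖g u‖ ≤ ‖s‖ * ‖f u‖ := fun u => by
    have hf : f u = ∑ x : u.support, annih X.toCorr ρ x.1 (u x.1) :=
      (Finset.sum_coe_sort u.support fun x => annih X.toCorr ρ x (u x)).symm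
    have hg : g u = ∑ x : u.support, annih X.toCorr σ x.1 (s (u x.1)) :=
      (Finset.sum_coe_sort u.support fun x => annih X.toCorr σ x (s (u x))).symm
    rw [hf, hg]
    exact X.norm_sum_annih_map_le ρ σ s hs _ _
  obtain ⟨t, htn, htf, ht0⟩ := exists_clm_comp_eq f g (norm_nonneg s) hfg
  have hfx : ∀ x w, f (Finsupp.single x w) = annih X.toCorr ρ x w := fun x w => by simp [f]
  have htx : ∀ x w, t (annih X.toCorr ρ x w) = annih X.toCorr σ x (s w) := fun x w => by
    rw [← hfx, htf]
    simp [g]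
  have ht : ∀ b, t ∘L ρ b = σ b ∘L t := fun b => by
    have hS : (LinearMap.range f).topologicalClosure ≤ (t ∘L ρ b - σ b ∘L t).ker := by
      refine Submodule.topologicalClosure_minimal _ ?_ (ContinuousLinearMap.isClosed_ker _)
      rintro _ ⟨u, rfl⟩
      induction u using Finsupp.induction_linear with
      | zero => rw [map_zero]; exact Submodule.zero_mem _
      | add u v hu hv => rw [map_add]; exact Submodule.add_mem _ hu hv
      | single x w =>
        rw [hfx, LinearMap.mem_ker]
        change t (ρ b _) - σ b (t _) = 0
        -- `ρ(b) T_x^* = T_{x b*}^*`, and likewise for `σ`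
        rw [← annih_rmul, htx, htx, annih_rmul, sub_self]
    have : CompleteSpace (LinearMap.range f).topologicalClosure :=
      (Submodule.isClosed_topologicalClosure _).completeSpace_coe
    ext k
    obtain ⟨p, hp, q, hq, rfl⟩ :=
      (LinearMap.range f).topologicalClosure.exists_add_mem_mem_orthogonal k
    rw [Submodule.orthogonal_closure] at hq
    -- `q` is orthogonal to all `T_x^* (y ⊗ k) = ρ(⟨x, y⟩) k`, so `ρ` vanishes on it
    have hρq : ρ b q = 0 := X.rep_apply_eq_zero ρ (fun x y => ext_inner_left ℂ fun k => by
      rw [← star_star (X.ip x y), map_star, ContinuousLinearMap.star_eq_adjoint,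
        ContinuousLinearMap.adjoint_inner_right, X.star_ip, ← annih_indTmul, ← hfx,
        inner_zero_right]
      exact hq _ ⟨_, rfl⟩) b
    have hp' : t (ρ b p) = σ b (t p) := sub_eq_zero.mp (hS hp)
    rw [ContinuousLinearMap.comp_apply, ContinuousLinearMap.comp_apply, map_add, map_add, hρq,
      map_add, ht0 q hq, hp', map_zero, add_zero, add_zero]
  -- `T_x^* (y ⊗ t k) = t T_x^* (y ⊗ k) = T_x^* s (y ⊗ k)` for all `x`
  refine ⟨t, ht, htn, ind_ext fun y k => ext_annih fun x => ?_⟩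
  rw [ampl_indTmul X.toCorr ρ σ t ht, annih_indTmul, ← htx, annih_indTmul]
  exact (DFunLike.congr_fun (ht _) k).symm

variable {F : Corr N N} {σ}

/-- Under nondegeneracy of `σ` or of the left action on `F`, `t ↦ I_X ⊗ t` preserves the norm of
intertwiners. -/
theorem norm_ampl (hσF : RepNondegenerate σ ∨ F.LeftNondegenerate) {t : IndSpace F σ →L[ℂ] H}
    (ht : ∀ b, t ∘L indRep F σ b = σ b ∘L t) : ‖ampl X.toCorr (indRep F σ) σ t‖ = ‖t‖ := by
  refine le_antisymm (norm_ampl_le _ _ _ t ht) ?_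
  obtain ⟨r, hr, hrn, hrt⟩ := X.exists_ampl_eq (indRep F σ) σ _ (ampl_comp_indRep _ _ _ t ht)
  have hσ := X.rep_comp_eq_of_ampl_eq hr ht hrt
  have : r - t = 0 := by
    rcases hσF with h | h
    · exact h.eq_zero_of_comp fun b => by rw [ContinuousLinearMap.comp_sub, hσ, sub_self]
    · exact h.eq_zero_of_comp_indRep σ fun b => by
        rw [ContinuousLinearMap.sub_comp, hr, ht, hσ, sub_self]
  rwa [sub_eq_zero.mp this] at hrn

end EquivBimodule

/-! ### The Morita transform -/

section Transform

open Corr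

variable {M : Type*} {N : Type*} [NonUnitalCStarAlgebra M] [NonUnitalCStarAlgebra N]
  [PartialOrder M] [StarOrderedRing M] [PartialOrder N] [StarOrderedRing N]
  {H : Type*} [NormedAddCommGroup H] [InnerProductSpace ℂ H] [CompleteSpace H]

/-- Taking adjoints, `F^{σ*}` consists of all intertwiners from `F ⊗_σ H` to `H`. -/
theorem mem_sigmaDualStar_iff {F : Corr N N} {σ : N →⋆ₙₐ[ℂ] (H →L[ℂ] H)}
    {t : IndSpace F σ →L[ℂ] H} :
    t ∈ sigmaDualStar F σ ↔ ∀ b, t ∘L indRep F σ b = σ b ∘L t := by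
  refine ⟨sigmaDualStar_intertwines, fun h => ⟨ContinuousLinearMap.adjoint t, fun b => ?_,
    (ContinuousLinearMap.adjoint_adjoint t).symm⟩⟩
  have h1 := congrArg ContinuousLinearMap.adjoint (h (star b))
  rw [ContinuousLinearMap.adjoint_comp, ContinuousLinearMap.adjoint_comp, map_star σ b,
    map_star (indRep F σ) b,
    ContinuousLinearMap.star_eq_adjoint, ContinuousLinearMap.star_eq_adjoint,
    ContinuousLinearMap.adjoint_adjoint, ContinuousLinearMap.adjoint_adjoint] at h1
  exact h1.symm

variable {E : Corr M M} {F : Corr N N} (X : Corr M N)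
  (W : Iso (E.tensor X) (X.tensor F)) (σ : N →⋆ₙₐ[ℂ] (H →L[ℂ] H))

/-- `W ⊗ I_H` intertwines the left actions of `M`. -/
theorem tensorUnitary_indRep (a : M) (w : IndSpace E (indRep X σ)) :
    tensorUnitary X W σ (indRep E (indRep X σ) a w)
      = indRep X (indRep F σ) a (tensorUnitary X W σ w) := by
  obtain ⟨w, rfl⟩ := (assoc E X σ).surjective w
  change assoc X F σ (isoAmpl W σ ((assoc E X σ).symm _))
    = indRep X (indRep F σ) a (assoc X F σ (isoAmpl W σ ((assoc E X σ).symm _)))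
  rw [← assoc_indRep, LinearIsometryEquiv.symm_apply_apply, LinearIsometryEquiv.symm_apply_apply,
    isoAmpl_indRep, assoc_indRep]

theorem norm_moritaTransform (t : IndSpace F σ →L[ℂ] H) :
    ‖moritaTransform X W σ t‖ = ‖ampl X (indRep F σ) σ t‖ :=
  ContinuousLinearMap.opNorm_comp_linearIsometryEquiv _ _

variable {σ} in
theorem moritaTransform_mem_sigmaDualStar {t : IndSpace F σ →L[ℂ] H} (ht : t ∈ sigmaDualStar F σ) :
    moritaTransform X W σ t ∈ sigmaDualStar E (indRep X σ) := by
  rw [mem_sigmaDualStar_iff] at ht ⊢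
  intro a
  ext w
  change ampl X _ σ t (tensorUnitary X W σ (indRep E (indRep X σ) a w))
    = indRep X σ a (ampl X _ σ t (tensorUnitary X W σ w))
  rw [tensorUnitary_indRep]
  exact DFunLike.congr_fun (ampl_comp_indRep X _ σ t ht a) _

variable {σ} in
/-- Every operator in `E^{σ^X*}` is the transform of an operator in `F^{σ*}` of no larger norm. -/
theorem exists_moritaTransform_eq (X : EquivBimodule M N)
    (W : Iso (E.tensor X.toCorr) (X.toCorr.tensor F))
    {r : IndSpace E (indRep X.toCorr σ) →L[ℂ] IndSpace X.toCorr σ}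
    (hr : r ∈ sigmaDualStar E (indRep X.toCorr σ)) :
    ∃ t ∈ sigmaDualStar F σ, ‖t‖ ≤ ‖r‖ ∧ moritaTransform X.toCorr W σ t = r := by
  rw [mem_sigmaDualStar_iff] at hr
  let U := tensorUnitary X.toCorr W σ
  let S : IndSpace X.toCorr (indRep F σ) →L[ℂ] IndSpace X.toCorr σ :=
    r ∘L (U.symm : IndSpace X.toCorr (indRep F σ) →L[ℂ] IndSpace E (indRep X.toCorr σ))
  have hS : ∀ a, S ∘L indRep X.toCorr (indRep F σ) a = indRep X.toCorr σ a ∘L S := fun a => by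
    ext w
    obtain ⟨w, rfl⟩ := U.surjective w
    change r (U.symm (indRep X.toCorr (indRep F σ) a (tensorUnitary X.toCorr W σ w)))
      = indRep X.toCorr σ a (r (U.symm (U w)))
    rw [← tensorUnitary_indRep, U.symm_apply_apply, U.symm_apply_apply]
    exact DFunLike.congr_fun (hr a) w
  obtain ⟨t, ht, htn, htS⟩ := X.exists_ampl_eq _ σ S hS
  have hSr : ‖S‖ = ‖r‖ := ContinuousLinearMap.opNorm_comp_linearIsometryEquiv _ _
  refine ⟨t, mem_sigmaDualStar_iff.mpr ht, htn.trans_eq hSr, ?_⟩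
  rw [moritaTransform, htS]
  ext w
  exact congrArg r (U.symm_apply_apply w)

end Transform

end CStarMorita

end

theorem theorem3p1 {M N H : Type*} [NonUnitalCStarAlgebra M] [PartialOrder M]
    [StarOrderedRing M] [NonUnitalCStarAlgebra N] [PartialOrder N] [StarOrderedRing N]
    [NormedAddCommGroup H] [InnerProductSpace ℂ H] [CompleteSpace H]
    (E : CStarMorita.Corr M M) (F : CStarMorita.Corr N N) (X : CStarMorita.EquivBimodule M N)
    (W : CStarMorita.Corr.Iso (E.tensor X.toCorr) (X.toCorr.tensor F))
    (σ : N →⋆ₙₐ[ℂ] (H →L[ℂ] H))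
    (hσF : CStarMorita.RepNondegenerate σ ∨ F.LeftNondegenerate) :
    Set.MapsTo (CStarMorita.moritaTransform X.toCorr W σ) (CStarMorita.closedDisc F σ)
        (CStarMorita.closedDisc E (CStarMorita.Corr.indRep X.toCorr σ)) ∧
      (∀ s ∈ CStarMorita.closedDisc F σ, ∀ t ∈ CStarMorita.closedDisc F σ,
        dist (CStarMorita.moritaTransform X.toCorr W σ s)
          (CStarMorita.moritaTransform X.toCorr W σ t) = dist s t) ∧
      Set.SurjOn (CStarMorita.moritaTransform X.toCorr W σ) (CStarMorita.closedDisc F σ)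
        (CStarMorita.closedDisc E (CStarMorita.Corr.indRep X.toCorr σ)) := by
  refine ⟨fun t ⟨ht, htn⟩ => ⟨CStarMorita.moritaTransform_mem_sigmaDualStar X.toCorr W ht, ?_⟩,
    fun s ⟨hs, _⟩ t ⟨ht, _⟩ => ?_, fun r ⟨hr, hrn⟩ => ?_⟩
  · rw [CStarMorita.norm_moritaTransform]
    exact (CStarMorita.Corr.norm_ampl_le _ _ _ t
      (CStarMorita.mem_sigmaDualStar_iff.mp ht)).trans htn
  · rw [CStarMorita.mem_sigmaDualStar_iff] at hs ht
    have hst : ∀ b, (s - t) ∘L CStarMorita.Corr.indRep F σ b = σ b ∘L (s - t) := fun b => by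
      rw [ContinuousLinearMap.sub_comp, ContinuousLinearMap.comp_sub, hs, ht]
    rw [dist_eq_norm, dist_eq_norm, ← X.norm_ampl hσF hst,
      ← CStarMorita.norm_moritaTransform X.toCorr W σ (s - t)]
    unfold CStarMorita.moritaTransform
    rw [CStarMorita.Corr.ampl_sub _ _ _ s t hs ht, ContinuousLinearMap.sub_comp]
  · obtain ⟨t, ht, htn, h⟩ := CStarMorita.exists_moritaTransform_eq X W hr
    exact ⟨t, ⟨ht, htn.trans hrn⟩, h⟩
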